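/- For positive integers $n,N,M$ let $p_n(N,M)$ be the number of partitions of $n$ all of whose parts are at most $N$ and which have at most $M$ parts, and put $\alpha=N/\sqrt n$, $\beta=M/\sqrt n$. Let $\mathrm{Li}_2(x)=\sum_{k\ge 1}x^k/k^2$ for $|x|\le 1$. For all real $\alpha,\beta\ge 4$ the equation $$g^2=\mathrm{Li}_2(1-e^{-\alpha g})+\mathrm{Li}_2(1-e^{-\beta g})-\mathrm{Li}_2(1-e^{-(\alpha+\beta)g})$$ has a unique solution $g=g(\alpha,\beta)>0$. With this $g$ put $$L(\alpha,\beta)=2g^2+\frac{(\alpha+\beta)^2g^2}{e^{(\alpha+\beta)g}-1}-\frac{\alpha^2g^2}{e^{\alpha g}-1}-\frac{\beta^2g^2}{e^{\beta g}-1},$$ $$K(\alpha,\beta)=g+\frac1g\Big(\frac{\pi^2}{6}+\mathrm{Li}_2(e^{-(\alpha+\beta)g})-\mathrm{Li}_2(e^{-\alpha g})-\mathrm{Li}_2(e^{-\beta g})\Big).$$ Then $L(\alpha,\beta)>0$ for all real $\alpha,\beta\ge 4$. Let $\varepsilon\in(0,1/8)$. Then, as $n\to\infty$, uniformly for all integers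 $N\ge 4\sqrt n$ and $M\ge 4\sqrt n$, $$p_n(N,M)=\frac{g^2}{2\pi\sqrt{L(\alpha,\beta)}}\sqrt{\frac{1-e^{-(\alpha+\beta)g}}{(1-e^{-\alpha g})(1-e^{-\beta g})}}\cdot\frac{e^{\sqrt n\,K(\alpha,\beta)}}{n}\,\Big(1+O\big(n^{-1/4+\varepsilon}\big)\Big),\qquad g=g(\alpha,\beta),$$ where the implied constant depends only on $\varepsilon$. -/

import Mathlib

open Filter

noncomputable section

/-- `restrictedPartitionCount n N M` is `p_n(N, M)`: the number of partitions of `n` all of whose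
parts are at most `N` and which have at most `M` parts. -/
def restrictedPartitionCount (n N M : ℕ) : ℕ :=
  (Finset.univ.filter fun p : n.Partition =>
    (∀ i ∈ p.parts, i ≤ N) ∧ p.parts.card ≤ M).card

/-- The real dilogarithm `Li₂(x) = ∑_{k ≥ 1} x ^ k / k ^ 2`; the series converges for `|x| ≤ 1`,
and below the argument always lies in `(0, 1)`. -/
def dilog (x : ℝ) : ℝ :=
  ∑' k : ℕ, x ^ (k + 1) / ((k : ℝ) + 1) ^ 2

/-- `g` is a positive solution of
`g² = Li₂(1 - e^{-αg}) + Li₂(1 - e^{-βg}) - Li₂(1 - e^{-(α+β)g})`. -/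
def IsSaddlePoint (α β g : ℝ) : Prop :=
  0 < g ∧
    g ^ 2 = dilog (1 - Real.exp (-(α * g))) + dilog (1 - Real.exp (-(β * g)))
      - dilog (1 - Real.exp (-((α + β) * g)))

/-- The quantity `L(α, β)`, written in terms of `α`, `β` and `g = g(α, β)`. -/
def saddleL (α β g : ℝ) : ℝ :=
  2 * g ^ 2 + (α + β) ^ 2 * g ^ 2 / (Real.exp ((α + β) * g) - 1)
    - α ^ 2 * g ^ 2 / (Real.exp (α * g) - 1)
    - β ^ 2 * g ^ 2 / (Real.exp (β * g) - 1)

/-- The quantity `K(α, β)`, written in terms of `α`, `β` and `g = g(α, β)`. -/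
def saddleK (α β g : ℝ) : ℝ :=
  g + 1 / g * (Real.pi ^ 2 / 6 + dilog (Real.exp (-((α + β) * g)))
    - dilog (Real.exp (-(α * g))) - dilog (Real.exp (-(β * g))))

/-- The main term of the asymptotic formula for `p_n(α√n, β√n)`, with `g = g(α, β)`. -/
def mainTerm (n : ℕ) (α β g : ℝ) : ℝ :=
  g ^ 2 / (2 * Real.pi * √(saddleL α β g))
    * √((1 - Real.exp (-((α + β) * g)))
        / ((1 - Real.exp (-(α * g))) * (1 - Real.exp (-(β * g)))))
    * (Real.exp (√(n : ℝ) * saddleK α β g) / (n : ℝ))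

end

/-! The generating function in `n` of the counts is the Gaussian binomial `∏_{j≤N+M}(1-z^j) /
(∏_{j≤N}(1-z^j) ∏_{j≤M}(1-z^j))`. Its coefficient is a Cauchy integral over `|z| = e^{-v}`, and the
theorem is the saddle point method at `v = g/√n` (`restrictedPartitionCount_eq_integral`).

Saddle point. In the scaled variables `αg = Nv`, `βg = Mv` the equation for `g` says that the
continuous approximation to the first cumulant equals `n`. Dividing its right side by `g²` gives a
function whose derivative has the opposite sign to `P(αg) + P(βg) - P((α+β)g)`, where `P =
varPrimitive` has a strictly decreasing derivative and is therefore strictly subadditive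
(`varPrimitive_add_lt`). This gives uniqueness; at the saddle the same combination of `P` is `L`,
the scaled second cumulant. For `α, β ≥ 4` the root lies in `[6/5, 1.3]`, so `Nv, Mv ≥ 4.8`, and `L`
lies in a fixed positive interval. All later constants are therefore uniform in `N, M`.

Central arc. Sums over `j` are compared with integrals: the first cumulant is right up to `O(1/v)`,
the second up to `O(1/v²)`, the logarithm of the value at `θ = 0` up to `O(v)`
(`sum_log_one_sub_exp_neg`), and the cubic remainder is `O(|θ|³/v⁴)` (`norm_logFactorSum_sub_le`).
For `|θ| ≤ v^{3/2-ε/2}` the integrand is thus a Gaussian with relative error `O(v^{1/2-2ε})`.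

Outer arc. The numerator factors with index in `(M, M+N]` could make the integrand large. Each is
controlled by the denominator factors at its two half indices, so that they undo at most 9/10 of the
decay (`sum_log_tail_le`). The remaining tenth gives decay `exp(-c min(1/v, θ²/v³))`
(`re_logFactorSum_le`), which is at most `exp(-c v^{-ε})` there. -/

/-! ### The dilogarithm on `[0, 1]`. -/

theorem summable_one_div_add_one_sq : Summable fun k : ℕ => 1 / ((k : ℝ) + 1) ^ 2 := by
  have := (summable_nat_add_iff 1).2 hasSum_zeta_two.summable
  simpa using this

theorem norm_dilog_term_le {x : ℝ} (hx : |x| ≤ 1) (k : ℕ) :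
    ‖x ^ (k + 1) / ((k : ℝ) + 1) ^ 2‖ ≤ 1 / ((k : ℝ) + 1) ^ 2 := by
  rw [norm_div, norm_pow, Real.norm_eq_abs, Real.norm_of_nonneg (by positivity)]
  gcongr
  exact pow_le_one₀ (abs_nonneg _) hx

theorem summable_dilog {x : ℝ} (hx : |x| ≤ 1) :
    Summable fun k : ℕ => x ^ (k + 1) / ((k : ℝ) + 1) ^ 2 :=
  Summable.of_norm_bounded summable_one_div_add_one_sq (norm_dilog_term_le hx)

theorem dilog_zero : dilog 0 = 0 := by simp [dilog]

theorem dilog_one : dilog 1 = Real.pi ^ 2 / 6 := by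
  have h := hasSum_zeta_two
  rw [← hasSum_nat_add_iff' 1] at h
  have := h.tsum_eq
  simpa [dilog] using this

theorem dilog_monotoneOn : MonotoneOn dilog (Set.Icc 0 1) := by
  intro x hx y hy hxy
  refine Summable.tsum_le_tsum (fun k => ?_) (summable_dilog ?_) (summable_dilog ?_)
  · have := hx.1
    gcongr
  · rw [abs_of_nonneg hx.1]; exact hx.2
  · rw [abs_of_nonneg hy.1]; exact hy.2

theorem dilog_continuousOn : ContinuousOn dilog (Set.Icc 0 1) := by
  refine continuousOn_tsum (fun k => by fun_prop) summable_one_div_add_one_sq ?_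
  intro k x hx
  exact norm_dilog_term_le (by rw [abs_of_nonneg hx.1]; exact hx.2) k

/-- Termwise differentiation on `(-ρ, ρ)` with `x < ρ < 1`, dominated by the geometric series in
`ρ`; the derived series is that of the logarithm divided by `x`. -/
theorem dilog_hasDerivAt {x : ℝ} (h0 : 0 < x) (h1 : x < 1) :
    HasDerivAt dilog (-Real.log (1 - x) / x) x := by
  obtain ⟨ρ, hρ, hρ1⟩ := exists_between h1
  have hρ0 : 0 < ρ := h0.trans hρ
  have key : HasDerivAt dilog (∑' k : ℕ, x ^ k / ((k : ℝ) + 1)) x := by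
    refine hasDerivAt_tsum_of_isPreconnected (u := fun k : ℕ => ρ ^ k)
      (summable_geometric_of_lt_one hρ0.le hρ1)
      (t := Set.Ioo (-ρ) ρ) isOpen_Ioo isPreconnected_Ioo (g := fun k x => x ^ (k + 1) / ((k : ℝ) + 1) ^ 2)
      (g' := fun k x => x ^ k / ((k : ℝ) + 1)) (y₀ := x) ?_ ?_ ⟨by linarith, hρ⟩
      (summable_dilog (by rw [abs_of_pos h0]; exact h1.le)) ⟨by linarith, hρ⟩
    · intro k y _
      have := (hasDerivAt_pow (k + 1) y).div_const (((k : ℝ) + 1) ^ 2)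
      refine this.congr_deriv ?_
      push_cast
      field_simp

    · intro k y hy
      rw [norm_div, norm_pow, Real.norm_eq_abs, Real.norm_of_nonneg (by positivity)]
      refine (div_le_self (by positivity) (by simp)).trans ?_
      exact pow_le_pow_left₀ (abs_nonneg _) (abs_le.2 ⟨hy.1.le, hy.2.le⟩) _
  refine key.congr_deriv (Eq.symm ?_)
  have h := (Real.hasSum_pow_div_log_of_abs_lt_one (x := x) (by rw [abs_of_pos h0]; exact h1)).div_const x
  rw [← h.tsum_eq]
  refine tsum_congr fun k => ?_
  field_simp
  ring

/-! ### Closed-form primitives of `t / (eᵗ - 1)` and `log (1 - e⁻ᵗ)`. -/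

/-- The integral `∫₀ˣ t / (eᵗ - 1) dt` in closed form. -/
noncomputable def debye (x : ℝ) : ℝ := dilog (1 - Real.exp (-x))

theorem one_sub_exp_neg_mem {x : ℝ} (hx : 0 ≤ x) : 1 - Real.exp (-x) ∈ Set.Icc (0 : ℝ) 1 :=
  ⟨by linarith [Real.exp_le_one_iff.2 (neg_nonpos.2 hx)], by linarith [Real.exp_pos (-x)]⟩

theorem exp_neg_mem {x : ℝ} (hx : 0 ≤ x) : Real.exp (-x) ∈ Set.Icc (0 : ℝ) 1 :=
  ⟨(Real.exp_pos _).le, Real.exp_le_one_iff.2 (neg_nonpos.2 hx)⟩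

theorem debye_zero : debye 0 = 0 := by simp [debye, dilog_zero]

theorem debye_le {x : ℝ} (hx : 0 ≤ x) : debye x ≤ Real.pi ^ 2 / 6 := by
  rw [← dilog_one]
  exact dilog_monotoneOn (one_sub_exp_neg_mem hx) (by simp) (one_sub_exp_neg_mem hx).2

theorem debye_mono {x y : ℝ} (hx : 0 ≤ x) (hxy : x ≤ y) : debye x ≤ debye y :=
  dilog_monotoneOn (one_sub_exp_neg_mem hx) (one_sub_exp_neg_mem (hx.trans hxy)) (by gcongr)

theorem debye_continuousOn : ContinuousOn debye (Set.Ici 0) :=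
  dilog_continuousOn.comp (by fun_prop) fun _ hx => one_sub_exp_neg_mem hx

theorem debye_hasDerivAt {x : ℝ} (hx : 0 < x) :
    HasDerivAt debye (x / (Real.exp x - 1)) x := by
  have he : Real.exp (-x) < 1 := Real.exp_lt_one_iff.2 (by linarith)
  have h1 : HasDerivAt (fun x => 1 - Real.exp (-x)) (Real.exp (-x)) x := by
    simpa using ((hasDerivAt_neg x).exp.const_sub 1)
  have h2 := (dilog_hasDerivAt (x := 1 - Real.exp (-x)) (by linarith)
    (by linarith [Real.exp_pos (-x)])).comp x h1
  refine HasDerivAt.congr_deriv (f := debye) h2 ?_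
  have : Real.exp x - 1 ≠ 0 := by linarith [Real.one_lt_exp_iff.2 hx]
  rw [sub_sub_cancel, Real.log_exp, Real.exp_neg] at *
  have h3 := Real.exp_pos x
  have : 1 - (Real.exp x)⁻¹ ≠ 0 := by linarith
  field_simp

theorem debye_tendsto : Tendsto debye atTop (nhds (Real.pi ^ 2 / 6)) := by
  rw [← dilog_one]
  have h := dilog_continuousOn 1 (by simp)
  refine Tendsto.comp h (tendsto_nhdsWithin_iff.2 ⟨?_, ?_⟩)
  · have := (Real.tendsto_exp_neg_atTop_nhds_zero).const_sub 1
    simpa using this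
  · filter_upwards [eventually_ge_atTop 0] with x hx using one_sub_exp_neg_mem hx

/-- The integral `∫₀ˣ log (1 - e⁻ᵗ) dt` in closed form. -/
noncomputable def logOneSubExpPrimitive (x : ℝ) : ℝ := dilog (Real.exp (-x)) - Real.pi ^ 2 / 6

theorem logOneSubExpPrimitive_zero : logOneSubExpPrimitive 0 = 0 := by
  simp [logOneSubExpPrimitive, dilog_one]

theorem logOneSubExpPrimitive_continuousOn : ContinuousOn logOneSubExpPrimitive (Set.Ici 0) :=
  (dilog_continuousOn.comp (f := fun x => Real.exp (-x)) (by fun_prop) fun _ hx => exp_neg_mem hx).sub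
    continuousOn_const

theorem logOneSubExpPrimitive_hasDerivAt {x : ℝ} (hx : 0 < x) :
    HasDerivAt logOneSubExpPrimitive (Real.log (1 - Real.exp (-x))) x := by
  have he : Real.exp (-x) < 1 := Real.exp_lt_one_iff.2 (by linarith)
  have h1 : HasDerivAt (fun x => Real.exp (-x)) (-Real.exp (-x)) x := by
    simpa using (hasDerivAt_neg x).exp
  have h2 := ((dilog_hasDerivAt (x := Real.exp (-x)) (Real.exp_pos _) he).comp x h1).sub_const
    (Real.pi ^ 2 / 6)
  refine HasDerivAt.congr_deriv (f := logOneSubExpPrimitive) h2 ?_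
  have h3 := Real.exp_pos (-x)
  field_simp

/-! ### The mean and variance kernels, and subadditivity of the variance primitive. -/

theorem exp_sub_one_pos {t : ℝ} (ht : 0 < t) : 0 < Real.exp t - 1 := by
  linarith [Real.one_lt_exp_iff.2 ht]

theorem div_exp_sub_one_le_one {t : ℝ} (ht : 0 < t) : t / (Real.exp t - 1) ≤ 1 := by
  rw [div_le_one (exp_sub_one_pos ht)]
  linarith [Real.add_one_le_exp t]

theorem div_exp_sub_one_antitoneOn :
    AntitoneOn (fun t : ℝ => t / (Real.exp t - 1)) (Set.Ioi 0) := by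
  have hd : ∀ t ∈ Set.Ioi (0 : ℝ), HasDerivAt (fun t : ℝ => t / (Real.exp t - 1))
      ((1 * (Real.exp t - 1) - t * Real.exp t) / (Real.exp t - 1) ^ 2) t := fun t ht =>
    (hasDerivAt_id t).div ((Real.hasDerivAt_exp t).sub_const 1) (exp_sub_one_pos ht).ne'
  refine antitoneOn_of_deriv_nonpos (convex_Ioi 0)
    (fun t ht => (hd t ht).continuousAt.continuousWithinAt)
    (fun t ht => (hd t (by simpa using ht)).differentiableAt.differentiableWithinAt) ?_
  intro t ht
  rw [interior_Ioi] at ht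
  rw [(hd t ht).deriv]
  refine div_nonpos_of_nonpos_of_nonneg ?_ (sq_nonneg _)
  have h1 := Real.add_one_le_exp (-t)
  have h2 := Real.exp_pos t
  have h3 : Real.exp (-t) * Real.exp t = 1 := by rw [← Real.exp_add]; simp
  nlinarith

/-- The variance kernel `t² eᵗ / (eᵗ - 1)²`. -/
noncomputable def varKernel (t : ℝ) : ℝ := t ^ 2 * Real.exp t / (Real.exp t - 1) ^ 2

theorem exp_sub_one_sq (t : ℝ) :
    (Real.exp t - 1) ^ 2 = 4 * Real.sinh (t / 2) ^ 2 * Real.exp t := by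
  have h1 : Real.exp t = Real.exp (t / 2) ^ 2 := by rw [← Real.exp_nat_mul]; congr 1; ring
  have h2 : Real.exp (t / 2) * Real.exp (-(t / 2)) = 1 := by rw [← Real.exp_add]; simp
  rw [h1, Real.sinh_eq]
  have : 4 * ((Real.exp (t / 2) - Real.exp (-(t / 2))) / 2) ^ 2 * Real.exp (t / 2) ^ 2 =
    (Real.exp (t / 2) ^ 2 - Real.exp (t / 2) * Real.exp (-(t / 2))) ^ 2 := by ring
  rw [this, h2]

/-- In the form `(u / sinh u)²` with `u = t/2`, the upper bound 1 and strict monotonicity reduce to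
`u ≤ sinh u` and `sinh u < u cosh u`. -/
theorem varKernel_eq (t : ℝ) : varKernel t = (t / 2 / Real.sinh (t / 2)) ^ 2 := by
  rw [varKernel, exp_sub_one_sq]
  have := Real.exp_pos t
  rw [mul_div_mul_right _ _ this.ne', div_pow, div_pow]
  rw [div_div]; norm_num

theorem varKernel_pos {t : ℝ} (ht : 0 < t) : 0 < varKernel t := by
  have := exp_sub_one_pos ht
  unfold varKernel
  positivity

theorem varKernel_le_one {t : ℝ} (ht : 0 < t) : varKernel t ≤ 1 := by
  have hs : t / 2 ≤ Real.sinh (t / 2) := Real.self_le_sinh_iff.2 (by linarith)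
  rw [varKernel_eq]
  refine pow_le_one₀ (by positivity) ?_
  rw [div_le_one (by linarith)]
  exact hs

theorem sinh_lt_mul_cosh {t : ℝ} (ht : 0 < t) : Real.sinh t < t * Real.cosh t := by
  have hd : ∀ t : ℝ, HasDerivAt (fun t : ℝ => t * Real.cosh t - Real.sinh t)
      (1 * Real.cosh t + t * Real.sinh t - Real.cosh t) t := fun t =>
    ((hasDerivAt_id t).mul (Real.hasDerivAt_cosh t)).sub (Real.hasDerivAt_sinh t)
  have hm : StrictMonoOn (fun t : ℝ => t * Real.cosh t - Real.sinh t) (Set.Ici 0) := by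
    refine strictMonoOn_of_deriv_pos (convex_Ici 0)
      (fun t _ => (hd t).continuousAt.continuousWithinAt) ?_
    intro t ht
    rw [interior_Ici] at ht
    rw [(hd t).deriv]
    have : 0 < t * Real.sinh t := mul_pos ht (Real.sinh_pos_iff.2 ht)
    linarith
  have := hm (by simp) (Set.mem_Ici.2 ht.le) ht
  simp at this
  linarith

theorem div_sinh_strictAntiOn :
    StrictAntiOn (fun t : ℝ => t / Real.sinh t) (Set.Ioi 0) := by
  have hd : ∀ t ∈ Set.Ioi (0 : ℝ), HasDerivAt (fun t : ℝ => t / Real.sinh t)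
      ((1 * Real.sinh t - t * Real.cosh t) / Real.sinh t ^ 2) t := fun t ht =>
    (hasDerivAt_id t).div (Real.hasDerivAt_sinh t) (Real.sinh_pos_iff.2 ht).ne'
  refine strictAntiOn_of_deriv_neg (convex_Ioi 0)
    (fun t ht => (hd t ht).continuousAt.continuousWithinAt) ?_
  intro t ht
  rw [interior_Ioi] at ht
  rw [(hd t ht).deriv]
  have h1 := sinh_lt_mul_cosh ht
  have h2 : 0 < Real.sinh t := Real.sinh_pos_iff.2 ht
  refine div_neg_of_neg_of_pos (by linarith) (by positivity)

theorem varKernel_strictAntiOn : StrictAntiOn varKernel (Set.Ioi 0) := by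
  intro s hs t ht hst
  rw [Set.mem_Ioi] at hs ht
  rw [varKernel_eq, varKernel_eq]
  have h1 : 0 < Real.sinh (t / 2) := Real.sinh_pos_iff.2 (by linarith)
  refine pow_lt_pow_left₀ (div_sinh_strictAntiOn (a := s / 2) (b := t / 2) ?_ ?_ ?_) (by positivity) two_ne_zero
  · simp [hs]
  · simp [ht]
  · linarith

/-- The primitive of `varKernel` vanishing at `0`. -/
noncomputable def varPrimitive (x : ℝ) : ℝ := 2 * debye x - x ^ 2 / (Real.exp x - 1)

theorem varPrimitive_zero : varPrimitive 0 = 0 := by simp [varPrimitive, debye_zero]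

theorem varPrimitive_hasDerivAt {x : ℝ} (hx : 0 < x) :
    HasDerivAt varPrimitive (varKernel x) x := by
  have h0 := exp_sub_one_pos hx
  have h := ((debye_hasDerivAt hx).const_mul 2).sub
    ((hasDerivAt_pow 2 x).div ((Real.hasDerivAt_exp x).sub_const 1) h0.ne')
  refine HasDerivAt.congr_deriv (f := varPrimitive) h ?_
  unfold varKernel
  field_simp
  push_cast
  ring

theorem varPrimitive_continuousOn : ContinuousOn varPrimitive (Set.Ici 0) := by
  refine (debye_continuousOn.const_smul 2).sub ?_ |>.congr (fun x _ => by simp [varPrimitive]; rfl)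
  intro x hx
  rcases eq_or_lt_of_le (Set.mem_Ici.1 hx) with rfl | hx
  -- At 0 the quotient is `0/0 = 0` by convention, which is also its limit because it lies between 0
  -- and `x`.
  · have : Tendsto (fun x : ℝ => x ^ 2 / (Real.exp x - 1)) (nhdsWithin 0 (Set.Ici 0)) (nhds 0) := by
      refine tendsto_of_tendsto_of_tendsto_of_le_of_le' (h := fun x => x) tendsto_const_nhds
        (tendsto_id.mono_left nhdsWithin_le_nhds) ?_ ?_
      · filter_upwards [self_mem_nhdsWithin] with x hx
        have : 1 ≤ Real.exp x := Real.one_le_exp hx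
        exact div_nonneg (sq_nonneg _) (by linarith)
      · filter_upwards [self_mem_nhdsWithin] with x hx
        rcases eq_or_lt_of_le (Set.mem_Ici.1 hx) with rfl | hx
        · simp
        · have := mul_le_mul_of_nonneg_left (div_exp_sub_one_le_one hx) hx.le
          calc x ^ 2 / (Real.exp x - 1) = x * (x / (Real.exp x - 1)) := by ring
            _ ≤ _ := by linarith
    simpa [ContinuousWithinAt] using this
  · have := exp_sub_one_pos hx
    exact ContinuousAt.continuousWithinAt (by fun_prop (disch := positivity))

/-- The derivative `varKernel` is strictly decreasing, so `P(y) - P(x+y)` strictly increases from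
its value `-P(x)` at `y = 0`. -/
theorem varPrimitive_add_lt {x y : ℝ} (hx : 0 < x) (hy : 0 < y) :
    varPrimitive (x + y) < varPrimitive x + varPrimitive y := by
  have hm : StrictMonoOn (fun y => varPrimitive y - varPrimitive (x + y)) (Set.Ici 0) := by
    refine strictMonoOn_of_deriv_pos (convex_Ici 0) ?_ ?_
    · refine varPrimitive_continuousOn.sub (varPrimitive_continuousOn.comp (by fun_prop) ?_)
      intro y hy
      simp only [Set.mem_Ici] at hy ⊢
      linarith
    · intro y hy
      rw [interior_Ici, Set.mem_Ioi] at hy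
      have h := (varPrimitive_hasDerivAt hy).sub
        ((varPrimitive_hasDerivAt (x := x + y) (by linarith)).comp_const_add x y)
      erw [h.deriv]
      have := varKernel_strictAntiOn (Set.mem_Ioi.2 hy) (Set.mem_Ioi.2 (by linarith : 0 < x + y))
        (by linarith)
      linarith
  have := hm (by simp) (Set.mem_Ici.2 hy.le) hy
  simp [varPrimitive_zero] at this
  linarith

/-! ### Existence, uniqueness and numerical location of the saddle point. -/

/-- The right-hand side of the saddle point equation. -/
noncomputable def saddleRHS (α β g : ℝ) : ℝ := debye (α * g) + debye (β * g) - debye ((α + β) * g)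

theorem isSaddlePoint_iff {α β g : ℝ} :
    IsSaddlePoint α β g ↔ 0 < g ∧ g ^ 2 = saddleRHS α β g := Iff.rfl

/-- The saddle equation trades `2g²` for the `2 * debye` parts of `varPrimitive`. This identifies
`L` as the scaled variance. -/
theorem saddleL_eq {α β g : ℝ} (h : IsSaddlePoint α β g) :
    saddleL α β g = varPrimitive (α * g) + varPrimitive (β * g) - varPrimitive ((α + β) * g) := by
  have := (isSaddlePoint_iff.1 h).2
  simp only [saddleL, varPrimitive, saddleRHS] at *
  linear_combination 2 * this

/-- The derivative is `-(P(αg) + P(βg) - P(αg+βg)) / g³` with `P = varPrimitive`, negative by strict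
subadditivity. Dividing by `g²` turns the saddle equation into a monotone function taking the value
1. -/
theorem saddleRHS_div_sq_strictAntiOn {α β : ℝ} (hα : 0 < α) (hβ : 0 < β) :
    StrictAntiOn (fun g => saddleRHS α β g / g ^ 2) (Set.Ioi 0) := by
  have hc : ∀ c : ℝ, 0 < c → ∀ g : ℝ, 0 < g → HasDerivAt (fun g => debye (c * g))
      (c * g / (Real.exp (c * g) - 1) * c) g := fun c hc g hg => by
    have := (debye_hasDerivAt (x := c * g) (by positivity)).comp g ((hasDerivAt_id g).const_mul c)
    exact HasDerivAt.congr_deriv (f := fun g => debye (c * g)) this (by simp)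
  have hd : ∀ g ∈ Set.Ioi (0 : ℝ), HasDerivAt (fun g => saddleRHS α β g / g ^ 2)
      (-(varPrimitive (α * g) + varPrimitive (β * g) - varPrimitive (α * g + β * g)) / g ^ 3) g := by
    intro g hg
    rw [Set.mem_Ioi] at hg
    have h := ((((hc α hα g hg).add (hc β hβ g hg)).sub (hc (α + β) (by linarith) g hg)).div
      (hasDerivAt_pow 2 g) (by positivity))
    refine HasDerivAt.congr_deriv (f := fun g => saddleRHS α β g / g ^ 2) h ?_
    have h1 := exp_sub_one_pos (t := α * g) (by positivity)
    have h2 := exp_sub_one_pos (t := β * g) (by positivity)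
    have h3 := exp_sub_one_pos (t := (α + β) * g) (by positivity)
    rw [← add_mul]
    simp only [varPrimitive, Pi.add_apply, Pi.sub_apply]
    field_simp
    push_cast
    ring
  refine strictAntiOn_of_deriv_neg (convex_Ioi 0)
    (fun t ht => (hd t ht).continuousAt.continuousWithinAt) ?_
  intro g hg
  rw [interior_Ioi] at hg
  rw [(hd g hg).deriv]
  rw [Set.mem_Ioi] at hg
  have := varPrimitive_add_lt (x := α * g) (y := β * g) (by positivity) (by positivity)
  exact div_neg_of_neg_of_pos (by linarith) (by positivity)

theorem exp_four_point_eight_ge : 98 ≤ Real.exp 4.8 := by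
  have h1 : Real.exp 4.8 = Real.exp 1 ^ 4 * Real.exp 0.8 := by
    rw [← Real.exp_nat_mul, ← Real.exp_add]; norm_num
  have h2 := Real.exp_one_gt_d9
  have h3 := Real.add_one_le_exp (0.8 : ℝ)
  have h4 : (2.718 : ℝ) ^ 4 ≤ Real.exp 1 ^ 4 := by
    refine pow_le_pow_left₀ (by norm_num) (by linarith) 4
  rw [h1]
  calc (98 : ℝ) ≤ 2.718 ^ 4 * 1.8 := by norm_num
    _ ≤ _ := by gcongr; linarith

/-- Beyond 4.8 the integrand is at most `1.1 x e⁻ˣ`, a primitive of which is `-1.1 (x+1) e⁻ˣ`. Hence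
the function corrected by `1.1 (x+1) e⁻ˣ` decreases to its limit `π²/6`, and the correction at 4.8
is below 0.1. -/
theorem debye_four_point_eight_ge : Real.pi ^ 2 / 6 - 0.1 ≤ debye 4.8 := by
  have hd : ∀ x ∈ Set.Ici (4.8 : ℝ), HasDerivAt (fun x => debye x + 1.1 * ((x + 1) * Real.exp (-x)))
      (x / (Real.exp x - 1) + 1.1 * (1 * Real.exp (-x) + (x + 1) * (-Real.exp (-x)))) x := by
    intro x hx
    have hx : 4.8 ≤ x := hx
    have h1 : HasDerivAt (fun x => Real.exp (-x)) (-Real.exp (-x)) x := by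
      simpa using (hasDerivAt_neg x).exp
    exact (debye_hasDerivAt (by linarith)).add
      ((((hasDerivAt_id x).add_const 1).mul h1).const_mul 1.1)
  have ha : AntitoneOn (fun x => debye x + 1.1 * ((x + 1) * Real.exp (-x))) (Set.Ici 4.8) := by
    refine antitoneOn_of_deriv_nonpos (convex_Ici _)
      (fun t ht => (hd t ht).continuousAt.continuousWithinAt)
      (fun t ht => (hd t (interior_subset ht)).differentiableAt.differentiableWithinAt) ?_
    intro x hx
    have hx := interior_subset hx
    rw [(hd x hx).deriv]
    have hx : 4.8 ≤ x := hx
    have h1 : 98 ≤ Real.exp x := exp_four_point_eight_ge.trans (by gcongr)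
    have h2 : x / (Real.exp x - 1) ≤ 1.1 * (x * Real.exp (-x)) := by
      rw [Real.exp_neg, div_le_iff₀ (by linarith)]
      field_simp
      linarith
    linarith
  have ht : Tendsto (fun x => debye x + 1.1 * ((x + 1) * Real.exp (-x))) atTop
      (nhds (Real.pi ^ 2 / 6 + 1.1 * (0 + 0))) := by
    refine debye_tendsto.add (Tendsto.const_mul _ ?_)
    have h1 := Real.tendsto_pow_mul_exp_neg_atTop_nhds_zero 1
    have h2 := h1.add Real.tendsto_exp_neg_atTop_nhds_zero
    refine h2.congr fun x => by ring
  have h := le_of_tendsto ht (b := debye 4.8 + 1.1 * ((4.8 + 1) * Real.exp (-4.8))) (by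
    filter_upwards [eventually_ge_atTop 4.8] with x hx
    exact ha (by simp) (Set.mem_Ici.2 hx) hx)
  have h2 : Real.exp (-4.8) ≤ 1 / 98 := by
    rw [Real.exp_neg, ← one_div]
    exact one_div_le_one_div_of_le (by norm_num) exp_four_point_eight_ge
  norm_num at h h2 ⊢
  linarith

theorem saddleRHS_six_fifths {α β : ℝ} (hα : 4 ≤ α) (hβ : 4 ≤ β) :
    1.44 < saddleRHS α β (6 / 5) := by
  have h1 := debye_four_point_eight_ge
  have h2 : debye 4.8 ≤ debye (α * (6 / 5)) := debye_mono (by norm_num) (by linarith)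
  have h3 : debye 4.8 ≤ debye (β * (6 / 5)) := debye_mono (by norm_num) (by linarith)
  have h4 : debye ((α + β) * (6 / 5)) ≤ Real.pi ^ 2 / 6 := debye_le (by positivity)
  have h5 := Real.pi_gt_d2
  unfold saddleRHS
  nlinarith

theorem saddleRHS_le {α β g : ℝ} (hα : 0 ≤ α) (hβ : 0 ≤ β) (hg : 0 ≤ g) :
    saddleRHS α β g < 1.69 := by
  have h2 : debye (α * g) ≤ debye ((α + β) * g) :=
    debye_mono (by positivity) (by nlinarith [mul_nonneg hβ hg])
  have h4 : debye (β * g) ≤ Real.pi ^ 2 / 6 := debye_le (by positivity)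
  have h5 := Real.pi_lt_d2
  have h6 := Real.pi_pos
  unfold saddleRHS
  nlinarith

/-- The intermediate value theorem applies on `[1.2, 1.3]` because `1.2² = 1.44` and `1.3² = 1.69`
are exactly the lower and upper bounds proved for the right side. -/
theorem existsUnique_isSaddlePoint {α β : ℝ} (hα : 4 ≤ α) (hβ : 4 ≤ β) :
    ∃! g : ℝ, IsSaddlePoint α β g := by
  have hcont : ContinuousOn (fun g => saddleRHS α β g - g ^ 2) (Set.Icc (6 / 5) 1.3) := by
    have hc : ∀ c : ℝ, 0 ≤ c → ContinuousOn (fun g => debye (c * g)) (Set.Icc (6 / 5) 1.3) :=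
      fun c hc => debye_continuousOn.comp (by fun_prop) fun g hg => by
        have : 0 ≤ g := by linarith [hg.1]
        exact Set.mem_Ici.2 (by positivity)
    exact (((hc α (by linarith)).add (hc β (by linarith))).sub (hc (α + β) (by linarith))).sub
      (by fun_prop)
  obtain ⟨g, hg, hg0⟩ := intermediate_value_Icc' (by norm_num : (6 / 5 : ℝ) ≤ 1.3) hcont
    (show (0 : ℝ) ∈ _ from ⟨by
      have := saddleRHS_le (α := α) (β := β) (g := 1.3) (by linarith) (by linarith) (by norm_num)
      norm_num at this ⊢
      linarith, by
      have := saddleRHS_six_fifths hα hβ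
      norm_num at this ⊢
      linarith⟩)
  have hgpos : 0 < g := by linarith [hg.1]
  refine ⟨g, isSaddlePoint_iff.2 ⟨hgpos, by simp only at hg0; linarith⟩, ?_⟩
  intro g' hg'
  obtain ⟨h1, h2⟩ := isSaddlePoint_iff.1 hg'
  refine (saddleRHS_div_sq_strictAntiOn (α := α) (β := β) (by linarith) (by linarith)).injOn
    (Set.mem_Ioi.2 h1) (Set.mem_Ioi.2 hgpos) ?_
  simp only at hg0 ⊢
  rw [← h2, div_self (by positivity), eq_comm, div_eq_one_iff_eq (by positivity)]
  linarith

theorem IsSaddlePoint.bounds {α β g : ℝ} (hα : 4 ≤ α) (hβ : 4 ≤ β) (h : IsSaddlePoint α β g) :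
    6 / 5 ≤ g ∧ g ≤ 1.3 := by
  obtain ⟨h1, h2⟩ := isSaddlePoint_iff.1 h
  constructor
  · by_contra! hlt
    have h3 := saddleRHS_div_sq_strictAntiOn (α := α) (β := β) (by linarith) (by linarith)
      (Set.mem_Ioi.2 h1) (Set.mem_Ioi.2 (by norm_num : (0 : ℝ) < 6 / 5)) hlt
    simp only at h3
    rw [← h2, div_self (by positivity), div_lt_one (by norm_num)] at h3
    have := saddleRHS_six_fifths hα hβ
    norm_num at this h3
    linarith
  · have := saddleRHS_le (α := α) (β := β) (g := g) (by linarith) (by linarith) h1.le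
    by_contra! hlt
    nlinarith

theorem sq_div_exp_sub_one_le {t : ℝ} (ht : 4.8 ≤ t) : t ^ 2 / (Real.exp t - 1) ≤ 1.25 := by
  have h := Real.sum_le_exp_of_nonneg (x := t) (by linarith) 4
  simp [Finset.sum_range_succ, Nat.factorial] at h
  have h0 : 0 < t := by linarith
  rw [div_le_iff₀ (exp_sub_one_pos h0)]
  nlinarith [mul_nonneg (sub_nonneg.2 ht) (sq_nonneg t), sq_nonneg t]

/-- With `g ∈ [1.2, 1.3]` the term `2g²` lies in `[2.88, 3.38]`, and each exponential correction
lies in `[0, 1.25]` since its argument is at least 4.8. -/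
theorem IsSaddlePoint.saddleL_bounds {α β g : ℝ} (hα : 4 ≤ α) (hβ : 4 ≤ β)
    (h : IsSaddlePoint α β g) : 0.3 ≤ saddleL α β g ∧ saddleL α β g ≤ 5 := by
  obtain ⟨h1, h2⟩ := h.bounds hα hβ
  have e1 := sq_div_exp_sub_one_le (t := α * g) (by nlinarith)
  have e2 := sq_div_exp_sub_one_le (t := β * g) (by nlinarith)
  have e3 := sq_div_exp_sub_one_le (t := (α + β) * g) (by nlinarith)
  have p1 : 0 ≤ (α * g) ^ 2 / (Real.exp (α * g) - 1) :=
    div_nonneg (sq_nonneg _) (exp_sub_one_pos (by nlinarith)).le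
  have p2 : 0 ≤ (β * g) ^ 2 / (Real.exp (β * g) - 1) :=
    div_nonneg (sq_nonneg _) (exp_sub_one_pos (by nlinarith)).le
  have p3 : 0 ≤ ((α + β) * g) ^ 2 / (Real.exp ((α + β) * g) - 1) :=
    div_nonneg (sq_nonneg _) (exp_sub_one_pos (by nlinarith)).le
  unfold saddleL
  rw [← mul_pow, ← mul_pow, ← mul_pow]
  constructor <;> nlinarith

/-! ### Sums against integrals: Riemann sums, trapezoidal rule, Stirling. -/

/-- On each cell the error is at most `v` times the drop of `f`, and the drops telescope to at most
1. Nothing is assumed about `f` at 0, so the first cell uses `f ≤ 1` instead of `f 0`. -/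
theorem sum_antitone_le_primitive {f F : ℝ → ℝ} (hf : AntitoneOn f (Set.Ioi 0))
    (hf0 : ∀ x, 0 < x → 0 ≤ f x) (hf1 : ∀ x, 0 < x → f x ≤ 1) (hF : ContinuousOn F (Set.Ici 0))
    (hF0 : F 0 = 0) (hd : ∀ x, 0 < x → HasDerivAt F (f x) x) {v : ℝ} (hv : 0 < v) (X : ℕ) :
    |v * ∑ j ∈ Finset.range X, f ((j + 1) * v) - F (X * v)| ≤ v := by
  have step : ∀ a, 0 ≤ a → ∃ ξ, a < ξ ∧ ξ < a + v ∧ F (a + v) - F a = v * f ξ := by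
    intro a ha
    obtain ⟨ξ, hξ, h⟩ := exists_hasDerivAt_eq_slope F f (a := a) (b := a + v) (by linarith)
      (hF.mono fun x hx => Set.mem_Ici.2 (ha.trans hx.1)) (fun x hx => hd x (ha.trans_lt hx.1))
    refine ⟨ξ, hξ.1, hξ.2, ?_⟩
    rw [h, add_sub_cancel_left]
    field_simp
  have main : ∀ X : ℕ, 0 ≤ F ((X + 1 : ℕ) * v) - v * ∑ j ∈ Finset.range (X + 1), f ((j + 1) * v) ∧
      F ((X + 1 : ℕ) * v) - v * ∑ j ∈ Finset.range (X + 1), f ((j + 1) * v)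
        ≤ v * (1 - f ((X + 1 : ℕ) * v)) := by
    intro X
    induction X with
    | zero =>
      obtain ⟨ξ, h1, h2, h3⟩ := step 0 le_rfl
      rw [zero_add, hF0, sub_zero] at h3
      simp only [zero_add, Nat.cast_one, one_mul, Finset.sum_range_one, Nat.cast_zero, h3]
      have h4 := hf (Set.mem_Ioi.2 h1) (Set.mem_Ioi.2 hv) (by linarith)
      have h5 := hf1 ξ h1
      constructor <;> nlinarith
    | succ X ih =>
      obtain ⟨ξ, h1, h2, h3⟩ := step ((X + 1 : ℕ) * v) (by positivity)
      have e : ((X + 1 : ℕ) : ℝ) * v + v = ((X + 1 + 1 : ℕ) : ℝ) * v := by push_cast; ring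
      rw [e] at h2 h3
      have hp : 0 < ((X + 1 : ℕ) : ℝ) * v := by positivity
      have h4 := hf (Set.mem_Ioi.2 hp) (Set.mem_Ioi.2 (hp.trans h1)) h1.le
      have h5 := hf (Set.mem_Ioi.2 (hp.trans h1)) (Set.mem_Ioi.2 ((hp.trans h1).trans h2)) h2.le
      rw [Finset.sum_range_succ]
      have e2 : (((X + 1 : ℕ) : ℝ) + 1) * v = ((X + 1 + 1 : ℕ) : ℝ) * v := by push_cast; ring
      rw [e2]
      constructor <;> nlinarith
  rcases X with _ | X
  · simp [hF0, hv.le]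
  · obtain ⟨h1, h2⟩ := main X
    have h3 := hf0 ((X + 1 : ℕ) * v) (by positivity)
    rw [abs_le]
    constructor <;> nlinarith

/-- For convex `f` each cell has a nonnegative trapezoidal error of at most `v²/2` times the
increase of `f'`. These increases telescope, and `f'` stays in `[-1, 0]`. -/
theorem sum_trapezoid_le {f f' F : ℝ → ℝ} (hf : ContinuousOn f (Set.Ici 0)) (hf0 : f 0 = 0)
    (hfd : ∀ x, 0 < x → HasDerivAt f (f' x) x) (hm : MonotoneOn f' (Set.Ioi 0))
    (hl : ∀ x, 0 < x → -1 ≤ f' x) (hu : ∀ x, 0 < x → f' x ≤ 0)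
    (hF : ContinuousOn F (Set.Ici 0)) (hF0 : F 0 = 0) (hd : ∀ x, 0 < x → HasDerivAt F (f x) x)
    {v : ℝ} (hv : 0 < v) (X : ℕ) :
    |∑ j ∈ Finset.range X, f ((j + 1) * v) - f (X * v) / 2 - F (X * v) / v| ≤ v / 2 := by
  -- The lower bound `m` stands for the slope at the left end. It is `-1` for the first cell, where
  -- no derivative at 0 is available, and `f' a` afterwards.
  have step : ∀ a m, 0 ≤ a → (∀ x, a < x → m ≤ f' x) →
      0 ≤ v * (f a + f (a + v)) / 2 - (F (a + v) - F a) ∧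
      v * (f a + f (a + v)) / 2 - (F (a + v) - F a) ≤ v ^ 2 / 2 * (f' (a + v) - m) := by
    intro a m ha hma
    have hshift : ∀ t ∈ Set.Icc 0 v, a + t ∈ Set.Ici (0 : ℝ) := fun t ht =>
      Set.mem_Ici.2 (by linarith [ht.1])
    have hcont : ContinuousOn (fun t => t * (f a + f (a + t)) / 2 - (F (a + t) - F a))
        (Set.Icc 0 v) := by
      have h1 : ContinuousOn (fun t => f (a + t)) (Set.Icc 0 v) := hf.comp (by fun_prop) hshift
      have h2 : ContinuousOn (fun t => F (a + t)) (Set.Icc 0 v) := hF.comp (by fun_prop) hshift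
      exact ((continuousOn_id.mul (continuousOn_const.add h1)).div_const 2).sub
        (h2.sub continuousOn_const)
    -- The error as a function of the cell width `t` has derivative `t/2 * (f'(a+t) - f'(η))`, by a
    -- second mean value theorem for `f` on `[a, a+t]`.
    obtain ⟨ξ, hξ, h⟩ := exists_hasDerivAt_eq_slope
      (fun t => t * (f a + f (a + t)) / 2 - (F (a + t) - F a))
      (fun t => (1 * (f a + f (a + t)) + t * f' (a + t)) / 2 - f (a + t)) hv hcont
      (fun t ht => by
        have h1 := (hfd (a + t) (by linarith [ht.1])).comp_const_add a t
        have h2 := (hd (a + t) (by linarith [ht.1])).comp_const_add a t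
        exact ((((hasDerivAt_id t).mul (h1.const_add (f a))).div_const 2).sub (h2.sub_const (F a))))
    obtain ⟨η, hη, h'⟩ := exists_hasDerivAt_eq_slope f f' (a := a) (b := a + ξ) (by linarith [hξ.1])
      (hf.mono fun x hx => Set.mem_Ici.2 (ha.trans hx.1)) (fun x hx => hfd x (ha.trans_lt hx.1))
    have hξ0 := hξ.1
    have h1 : f (a + ξ) = f a + ξ * f' η := by
      rw [h', add_sub_cancel_left]
      field_simp
      ring
    have h2 : v * (f a + f (a + v)) / 2 - (F (a + v) - F a)
        = v * (ξ / 2 * (f' (a + ξ) - f' η)) := by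
      have : ξ / 2 * (f' (a + ξ) - f' η) = (1 * (f a + f (a + ξ)) + ξ * f' (a + ξ)) / 2 - f (a + ξ) := by
        rw [h1]; ring
      rw [this, h, add_zero, sub_zero]
      field_simp
      ring
    have hη0 : 0 < η := ha.trans_lt hη.1
    have h3 : f' η ≤ f' (a + ξ) := hm (Set.mem_Ioi.2 hη0) (Set.mem_Ioi.2 (by linarith)) hη.2.le
    have h4 : f' (a + ξ) ≤ f' (a + v) :=
      hm (Set.mem_Ioi.2 (by linarith)) (Set.mem_Ioi.2 (by linarith)) (by linarith [hξ.2])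
    have h5 := hma η hη.1
    rw [h2]
    refine ⟨by have := sub_nonneg.2 h3; positivity, ?_⟩
    calc v * (ξ / 2 * (f' (a + ξ) - f' η)) ≤ v * (v / 2 * (f' (a + v) - m)) := by
          have := sub_nonneg.2 h3
          have := hξ.2.le
          gcongr
      _ = _ := by ring
  have main : ∀ X : ℕ,
      0 ≤ v * (∑ j ∈ Finset.range (X + 1), f ((j + 1) * v) - f ((X + 1 : ℕ) * v) / 2)
        - F ((X + 1 : ℕ) * v) ∧
      v * (∑ j ∈ Finset.range (X + 1), f ((j + 1) * v) - f ((X + 1 : ℕ) * v) / 2)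
        - F ((X + 1 : ℕ) * v) ≤ v ^ 2 / 2 * (f' ((X + 1 : ℕ) * v) + 1) := by
    intro X
    induction X with
    | zero =>
      obtain ⟨h1, h2⟩ := step 0 (-1) le_rfl hl
      rw [zero_add, hF0, sub_zero, hf0] at h1 h2
      simp only [zero_add, Nat.cast_one, one_mul, Finset.sum_range_one, Nat.cast_zero]
      constructor <;> linarith
    | succ X ih =>
      have hp : 0 < ((X + 1 : ℕ) : ℝ) * v := by positivity
      obtain ⟨h1, h2⟩ := step ((X + 1 : ℕ) * v) (f' ((X + 1 : ℕ) * v)) hp.le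
        (fun x hx => hm (Set.mem_Ioi.2 hp) (Set.mem_Ioi.2 (hp.trans hx)) hx.le)
      have e : ((X + 1 : ℕ) : ℝ) * v + v = ((X + 1 + 1 : ℕ) : ℝ) * v := by push_cast; ring
      rw [e] at h1 h2
      rw [Finset.sum_range_succ]
      have e2 : (((X + 1 : ℕ) : ℝ) + 1) * v = ((X + 1 + 1 : ℕ) : ℝ) * v := by push_cast; ring
      rw [e2]
      constructor <;> nlinarith
  rcases X with _ | X
  · simpa [hF0, hf0] using by linarith
  · obtain ⟨h1, h2⟩ := main X
    have h3 := hu ((X + 1 : ℕ) * v) (by positivity)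
    have e : ∑ j ∈ Finset.range (X + 1), f ((j + 1) * v) - f ((X + 1 : ℕ) * v) / 2
          - F ((X + 1 : ℕ) * v) / v =
        (v * (∑ j ∈ Finset.range (X + 1), f ((j + 1) * v) - f ((X + 1 : ℕ) * v) / 2)
          - F ((X + 1 : ℕ) * v)) / v := by
      generalize f _ = p, F _ = q, (Finset.range _).sum (_ : ℕ → ℝ) = t
      field_simp
    rw [e, abs_of_nonneg (div_nonneg h1 hv.le), div_le_iff₀ hv]
    nlinarith [sq_nonneg v]

theorem abs_sum_div_exp_sub_one_sub_debye_le {v : ℝ} (hv : 0 < v) (X : ℕ) :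
    |∑ j ∈ Finset.range X, ((j : ℝ) + 1) / (Real.exp ((j + 1) * v) - 1) - debye (X * v) / v ^ 2|
      ≤ 1 / v := by
  have h := sum_antitone_le_primitive div_exp_sub_one_antitoneOn
    (fun x hx => div_nonneg hx.le (exp_sub_one_pos hx).le) (fun x hx => div_exp_sub_one_le_one hx)
    debye_continuousOn debye_zero (fun x hx => debye_hasDerivAt hx) hv X
  have e : ∑ j ∈ Finset.range X, ((j : ℝ) + 1) / (Real.exp ((j + 1) * v) - 1) - debye (X * v) / v ^ 2
      = (v * ∑ j ∈ Finset.range X, (((j : ℝ) + 1) * v) / (Real.exp ((j + 1) * v) - 1)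
        - debye (X * v)) / v ^ 2 := by
    have : ∑ j ∈ Finset.range X, (((j : ℝ) + 1) * v) / (Real.exp ((j + 1) * v) - 1) =
        v * ∑ j ∈ Finset.range X, ((j : ℝ) + 1) / (Real.exp ((j + 1) * v) - 1) := by
      rw [Finset.mul_sum]
      exact Finset.sum_congr rfl fun j _ => by ring
    rw [this]
    generalize debye _ = q, (Finset.range _).sum (_ : ℕ → ℝ) = t
    field_simp
  rw [e, abs_div, abs_of_pos (by positivity : 0 < v ^ 2), div_le_div_iff₀ (by positivity) hv]
  nlinarith

theorem abs_sum_variance_sub_varPrimitive_le {v : ℝ} (hv : 0 < v) (X : ℕ) :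
    |∑ j ∈ Finset.range X, ((j : ℝ) + 1) ^ 2 * Real.exp ((j + 1) * v) /
        (Real.exp ((j + 1) * v) - 1) ^ 2 - varPrimitive (X * v) / v ^ 3| ≤ 1 / v ^ 2 := by
  have h := sum_antitone_le_primitive varKernel_strictAntiOn.antitoneOn
    (fun x hx => (varKernel_pos hx).le) (fun x hx => varKernel_le_one hx)
    varPrimitive_continuousOn varPrimitive_zero (fun x hx => varPrimitive_hasDerivAt hx) hv X
  have e : ∑ j ∈ Finset.range X, ((j : ℝ) + 1) ^ 2 * Real.exp ((j + 1) * v) /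
        (Real.exp ((j + 1) * v) - 1) ^ 2 - varPrimitive (X * v) / v ^ 3
      = (v * ∑ j ∈ Finset.range X, varKernel ((j + 1) * v) - varPrimitive (X * v)) / v ^ 3 := by
    have : ∑ j ∈ Finset.range X, varKernel ((j + 1) * v) =
        v ^ 2 * ∑ j ∈ Finset.range X, ((j : ℝ) + 1) ^ 2 * Real.exp ((j + 1) * v) /
        (Real.exp ((j + 1) * v) - 1) ^ 2 := by
      rw [Finset.mul_sum]
      exact Finset.sum_congr rfl fun j _ => by unfold varKernel; ring
    rw [this]
    generalize varPrimitive _ = q, (Finset.range _).sum (_ : ℕ → ℝ) = t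
    field_simp
  rw [e, abs_div, abs_of_pos (by positivity : 0 < v ^ 3), div_le_div_iff₀ (by positivity) (by positivity)]
  have : 0 < v ^ 2 := by positivity
  nlinarith

/-- `stirlingSeq k` is at least its limit `√π`, whereas `log stirlingSeq k - 1/(12k)` increases to
`log √π`; the two sides of the bound follow. -/
theorem stirling_log_error {X : ℕ} (hX : X ≠ 0) :
    |Real.log X.factorial - (X * Real.log X - X + Real.log (2 * Real.pi * X) / 2)| ≤ 1 / (12 * X) := by
  have hX0 : 0 < (X : ℝ) := by positivity
  have h1 : Real.log √Real.pi ≤ Real.log (Stirling.stirlingSeq X) :=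
    Real.log_le_log (by positivity) (Stirling.sqrt_pi_le_stirlingSeq hX)
  have hstep : ∀ k : ℕ, Real.log (Stirling.stirlingSeq X) - 1 / (12 * X) ≤
      Real.log (Stirling.stirlingSeq (X + k)) - 1 / (12 * ((X + k : ℕ) : ℝ)) := by
    intro k
    induction k with
    | zero => simp
    | succ k ih =>
      have h := Stirling.log_stirlingSeq_sdiff_le (X + k)
      have hk : 0 < ((X + k : ℕ) : ℝ) := by positivity
      have e : 1 / (12 * ((X + k : ℕ) : ℝ) * (((X + k : ℕ) : ℝ) + 1)) =
          1 / (12 * ((X + k : ℕ) : ℝ)) - 1 / (12 * ((X + (k + 1) : ℕ) : ℝ)) := by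
        push_cast at hk ⊢
        have : (X : ℝ) + k + 1 ≠ 0 := by positivity
        have h3 : (X : ℝ) + (k + 1) ≠ 0 := by positivity
        field_simp
        ring
      rw [e] at h
      have e3 : X + k + 1 = X + (k + 1) := rfl
      rw [e3] at h
      linarith
  have hlim : Tendsto (fun k : ℕ => Real.log (Stirling.stirlingSeq (X + k))) atTop
      (nhds (Real.log √Real.pi)) := by
    have := (Real.continuousAt_log (x := √Real.pi) (by positivity)).tendsto.comp
      Stirling.tendsto_stirlingSeq_sqrt_pi
    have h2 := this.comp (tendsto_add_atTop_nat X)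
    refine h2.congr fun k => ?_
    simp [add_comm]
  have h2 : Real.log (Stirling.stirlingSeq X) - 1 / (12 * X) ≤ Real.log √Real.pi :=
    ge_of_tendsto' hlim fun k => (hstep k).trans (by
      have : 0 ≤ 1 / (12 * ((X + k : ℕ) : ℝ)) := by positivity
      linarith)
  rw [Stirling.log_stirlingSeq_formula, Real.log_sqrt Real.pi_pos.le,
    Real.log_div hX0.ne' (Real.exp_pos _).ne', Real.log_exp, Real.log_mul two_ne_zero hX0.ne'] at *
  rw [Real.log_mul (by positivity) hX0.ne', Real.log_mul two_ne_zero Real.pi_ne_zero, abs_le]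
  have : 0 ≤ 1 / (12 * (X : ℝ)) := by positivity
  constructor <;> linarith

theorem log_one_sub_exp_neg_sub_log_bounds {t : ℝ} (ht : 0 < t) :
    -t ≤ Real.log (1 - Real.exp (-t)) - Real.log t ∧
      Real.log (1 - Real.exp (-t)) - Real.log t ≤ 0 := by
  have h1 := Real.add_one_le_exp (-t)
  have h2 := Real.add_one_le_exp t
  have h3 : Real.exp (-t) * Real.exp t = 1 := by rw [← Real.exp_add]; simp
  have h4 := Real.exp_pos (-t)
  have h5 : t * Real.exp (-t) ≤ 1 - Real.exp (-t) := by nlinarith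
  have h6 : 0 < t * Real.exp (-t) := by positivity
  constructor
  · have := Real.log_le_log h6 h5
    rw [Real.log_mul ht.ne' h4.ne', Real.log_exp] at this
    linarith
  · have := Real.log_le_log (by linarith) (by linarith : 1 - Real.exp (-t) ≤ t)
    linarith

/-- The summand is singular at 0, so `log t` is split off. The regular part `log((1-e⁻ᵗ)/t)` is
convex with slope in `[-1, 0]` and is summed by the trapezoidal rule. The singular part sums to `log
X! + X log v`, and Stirling supplies the term `log(2π/v)/2`. -/
theorem sum_log_one_sub_exp_neg {v : ℝ} (hv : 0 < v) {X : ℕ} (hX : X ≠ 0) :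
    |∑ j ∈ Finset.range X, Real.log (1 - Real.exp (-((j + 1) * v))) -
      (logOneSubExpPrimitive (X * v) / v + Real.log (1 - Real.exp (-(X * v))) / 2
        + Real.log (2 * Real.pi / v) / 2)| ≤ v / 2 + 1 / (12 * X) := by
  have hX0 : 0 < (X : ℝ) := by positivity
  have hcont : ContinuousOn (fun t => Real.log (1 - Real.exp (-t)) - Real.log t) (Set.Ici 0) := by
    intro t ht
    rcases eq_or_lt_of_le (Set.mem_Ici.1 ht) with rfl | ht
    -- With `log 0 = 0` the function takes the value 0 at 0, which agrees with its limit.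
    · have : Tendsto (fun t => Real.log (1 - Real.exp (-t)) - Real.log t) (nhdsWithin 0 (Set.Ici 0))
          (nhds 0) := by
        have hneg : Tendsto (fun t : ℝ => -t) (nhdsWithin 0 (Set.Ici 0)) (nhds 0) := by
          have := (continuous_neg (G := ℝ)).tendsto 0
          rw [neg_zero] at this
          exact this.mono_left nhdsWithin_le_nhds
        refine tendsto_of_tendsto_of_tendsto_of_le_of_le' hneg tendsto_const_nhds ?_ ?_
        all_goals
          filter_upwards [self_mem_nhdsWithin] with x hx
          rcases eq_or_lt_of_le (Set.mem_Ici.1 hx) with rfl | hx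
          · simp
          · simp [log_one_sub_exp_neg_sub_log_bounds hx]
      simpa [ContinuousWithinAt] using this
    · have : Real.exp (-t) < 1 := Real.exp_lt_one_iff.2 (by linarith)
      have h1 : 1 - Real.exp (-t) ≠ 0 := by linarith
      have h2 : t ≠ 0 := ht.ne'
      exact ContinuousAt.continuousWithinAt (by fun_prop (disch := assumption))
  have hder : ∀ t, 0 < t → HasDerivAt (fun t => Real.log (1 - Real.exp (-t)) - Real.log t)
      (1 / (Real.exp t - 1) - 1 / t) t := by
    intro t ht
    have h0 : Real.exp (-t) < 1 := Real.exp_lt_one_iff.2 (by linarith)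
    have h1 : HasDerivAt (fun x => 1 - Real.exp (-x)) (Real.exp (-t)) t := by
      simpa using ((hasDerivAt_neg t).exp.const_sub 1)
    refine ((h1.log (by linarith)).sub (Real.hasDerivAt_log ht.ne')).congr_deriv ?_
    have h2 := exp_sub_one_pos ht
    have h3 : 1 - (Real.exp t)⁻¹ ≠ 0 := by rw [← Real.exp_neg]; linarith
    have h4 := Real.exp_pos t
    rw [Real.exp_neg, one_div, one_div]
    congr 1
    field_simp
  -- Convexity is `varKernel ≤ 1` again: the derivative is `(1 - varKernel t) / t²`.
  have hmono : MonotoneOn (fun t : ℝ => 1 / (Real.exp t - 1) - 1 / t) (Set.Ioi 0) := by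
    have hd : ∀ t ∈ Set.Ioi (0 : ℝ), HasDerivAt (fun t : ℝ => 1 / (Real.exp t - 1) - 1 / t)
        ((1 - varKernel t) / t ^ 2) t := by
      intro t ht
      have ht : 0 < t := ht
      have h0 := exp_sub_one_pos ht
      have h := (((Real.hasDerivAt_exp t).sub_const 1).inv h0.ne').sub (hasDerivAt_inv ht.ne')
      simp only [one_div]
      refine HasDerivAt.congr_deriv (f := fun t : ℝ => (Real.exp t - 1)⁻¹ - t⁻¹) h ?_
      unfold varKernel
      field_simp
      ring
    refine monotoneOn_of_deriv_nonneg (convex_Ioi 0)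
      (fun t ht => (hd t ht).continuousAt.continuousWithinAt)
      (fun t ht => (hd t (by simpa using ht)).differentiableAt.differentiableWithinAt) ?_
    intro t ht
    rw [interior_Ioi] at ht
    rw [(hd t ht).deriv]
    have := varKernel_le_one ht
    exact div_nonneg (by linarith) (sq_nonneg _)
  have hlower : ∀ t : ℝ, 0 < t → -1 ≤ 1 / (Real.exp t - 1) - 1 / t := by
    intro t ht
    have h0 := exp_sub_one_pos ht
    have h1 := Real.add_one_le_exp (-t)
    have h3 : Real.exp (-t) * Real.exp t = 1 := by rw [← Real.exp_add]; simp
    have h4 : Real.exp t - 1 ≤ t * Real.exp t := by nlinarith [Real.exp_pos t]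
    have h5 : 1 / t ≤ Real.exp t / (Real.exp t - 1) := by
      rw [div_le_div_iff₀ ht h0]
      linarith
    have h6 : Real.exp t / (Real.exp t - 1) = 1 + 1 / (Real.exp t - 1) := by
      field_simp
      ring
    linarith
  have hupper : ∀ t : ℝ, 0 < t → 1 / (Real.exp t - 1) - 1 / t ≤ 0 := by
    intro t ht
    have := one_div_le_one_div_of_le ht (by linarith [Real.add_one_le_exp t] : t ≤ Real.exp t - 1)
    linarith
  have hprim : ContinuousOn (fun x => logOneSubExpPrimitive x - (x * Real.log x - x)) (Set.Ici 0) :=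
    logOneSubExpPrimitive_continuousOn.sub
      (Real.continuous_mul_log.sub continuous_id).continuousOn
  have hprimd : ∀ t, 0 < t → HasDerivAt (fun x => logOneSubExpPrimitive x - (x * Real.log x - x))
      (Real.log (1 - Real.exp (-t)) - Real.log t) t := by
    intro t ht
    refine ((logOneSubExpPrimitive_hasDerivAt ht).sub
      ((Real.hasDerivAt_mul_log ht.ne').sub (hasDerivAt_id t))).congr_deriv ?_
    ring
  have h := sum_trapezoid_le hcont (by simp) hder hmono hlower hupper hprim
    (by simp [logOneSubExpPrimitive_zero]) hprimd hv X
  have hs := stirling_log_error hX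
  have hsum : ∑ j ∈ Finset.range X, (Real.log (1 - Real.exp (-((j + 1) * v))) -
      Real.log ((j + 1) * v)) = ∑ j ∈ Finset.range X, Real.log (1 - Real.exp (-((j + 1) * v)))
      - (Real.log X.factorial + X * Real.log v) := by
    rw [Finset.sum_sub_distrib]
    congr 1
    have : ∀ j ∈ Finset.range X, Real.log (((j : ℝ) + 1) * v) =
        Real.log ((j : ℝ) + 1) + Real.log v := fun j _ =>
      Real.log_mul (by positivity) hv.ne'
    rw [Finset.sum_congr rfl this, Finset.sum_add_distrib, Finset.sum_const, Finset.card_range,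
      nsmul_eq_mul, ← Finset.prod_range_add_one_eq_factorial, Nat.cast_prod,
      Real.log_prod (fun j _ => by positivity)]
    simp
  rw [hsum] at h
  have hXv : Real.log (X * v) = Real.log X + Real.log v := Real.log_mul hX0.ne' hv.ne'
  have h2 : Real.log (2 * Real.pi * X) = Real.log (2 * Real.pi) + Real.log X :=
    Real.log_mul (by positivity) hX0.ne'
  have h3 : Real.log (2 * Real.pi / v) = Real.log (2 * Real.pi) - Real.log v :=
    Real.log_div (by positivity) hv.ne'
  have e : (logOneSubExpPrimitive (X * v) - (X * v * Real.log (X * v) - X * v)) / v =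
      logOneSubExpPrimitive (X * v) / v - (X * (Real.log X + Real.log v) - X) := by
    rw [hXv]
    generalize logOneSubExpPrimitive _ = q
    field_simp
  rw [e, hXv] at h
  rw [h2] at hs
  rw [h3]
  have := (abs_add_le _ _).trans (add_le_add h hs)
  refine le_trans (le_of_eq ?_) this
  congr 1
  ring

/-! ### Second-order expansion of the factors near `θ = 0`. -/

theorem norm_exp_mul_I_sub_le (x : ℝ) :
    ‖Complex.exp (x * Complex.I) - (1 + x * Complex.I - x ^ 2 / 2)‖ ≤ 4 * |x| ^ 3 := by
  rcases le_total |x| 1 with hx | hx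
  · have h := Complex.norm_exp_sub_sum_le_norm_mul_exp (x * Complex.I) 3
    have e : ∑ m ∈ Finset.range 3, (x * Complex.I) ^ m / (m.factorial : ℂ)
        = 1 + x * Complex.I - x ^ 2 / 2 := by
      simp [Finset.sum_range_succ, Nat.factorial, mul_pow]
      ring
    rw [e] at h
    have hn : ‖(x : ℂ) * Complex.I‖ = |x| := by simp
    rw [hn] at h
    refine h.trans ?_
    have h1 : Real.exp |x| ≤ Real.exp 1 := Real.exp_le_exp.2 hx
    have h2 := Real.exp_one_lt_d9
    rw [mul_comm]
    gcongr
    linarith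
  · have h1 : ‖Complex.exp (x * Complex.I)‖ = 1 := Complex.norm_exp_ofReal_mul_I x
    have h2 : ‖(1 + x * Complex.I - x ^ 2 / 2 : ℂ)‖ ≤ 1 + |x| + |x| ^ 2 / 2 := by
      refine (norm_sub_le _ _).trans (add_le_add ((norm_add_le _ _).trans (by simp)) ?_)
      simp
    refine (norm_sub_le _ _).trans ?_
    rw [h1]
    have h3 : |x| ≤ |x| ^ 3 := by nlinarith [mul_nonneg (sub_nonneg.2 hx) (sub_nonneg.2 hx)]
    have h4 : |x| ^ 2 ≤ |x| ^ 3 := pow_le_pow_right₀ hx (by norm_num)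
    have h5 : 1 ≤ |x| ^ 3 := one_le_pow₀ hx
    linarith

/-- Expanding the logarithm in powers of `r` and each `e^{ikx}` to second order, the `k`-th error is
at most `4|x|³ k² rᵏ ≤ 4|x|³ k(k+1) rᵏ`, which sums exactly to the bound. Working on the series
avoids any branch question and any smallness condition on `x`. -/
theorem norm_log_factor_sub_le {r : ℝ} (h0 : 0 < r) (h1 : r < 1) (x : ℝ) :
    ‖-Complex.log (1 - r * Complex.exp (x * Complex.I)) + (Real.log (1 - r) : ℂ)
      - (x * (r / (1 - r) : ℝ) * Complex.I - x ^ 2 / 2 * (r / (1 - r) ^ 2 : ℝ))‖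
      ≤ 8 * |x| ^ 3 * (r / (1 - r) ^ 3) := by
  have hr : ‖(r : ℂ)‖ < 1 := by simpa [abs_of_pos h0] using h1
  have hr' : ‖r‖ < 1 := by simpa [abs_of_pos h0] using h1
  have hz : ‖(r : ℂ) * Complex.exp (x * Complex.I)‖ < 1 := by
    rw [norm_mul, Complex.norm_exp_ofReal_mul_I, mul_one]; exact hr
  have s1 := Complex.hasSum_taylorSeries_neg_log' hz
  have s2 := Complex.hasSum_taylorSeries_neg_log' hr
  have s3 : HasSum (fun k : ℕ => r ^ (k + 1)) (r / (1 - r)) := by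
    have := (hasSum_geometric_of_lt_one h0.le h1).mul_right r
    simpa [pow_succ, div_eq_inv_mul] using this
  have s4 : HasSum (fun k : ℕ => ((k : ℝ) + 1) * r ^ (k + 1)) (r / (1 - r) ^ 2) := by
    have := hasSum_coe_mul_geometric_of_norm_lt_one hr'
    rw [← hasSum_nat_add_iff' 1] at this
    simpa using this
  have s5 : HasSum (fun k : ℕ => 4 * |x| ^ 3 * (((k : ℝ) + 1) * ((k : ℝ) + 2) * r ^ (k + 1)))
      (8 * |x| ^ 3 * (r / (1 - r) ^ 3)) := by
    have := (hasSum_choose_mul_geometric_of_norm_lt_one 2 hr').mul_left (4 * |x| ^ 3 * (2 * r))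
    have e : 4 * |x| ^ 3 * (2 * r) * (1 / (1 - r) ^ (2 + 1)) = 8 * |x| ^ 3 * (r / (1 - r) ^ 3) := by
      ring
    rw [e] at this
    refine this.congr_fun fun k => ?_
    have : ((Nat.choose (k + 2) 2 : ℕ) : ℝ) = ((k : ℝ) + 1) * (k + 2) / 2 := by
      rw [Nat.cast_choose_two]
      push_cast
      ring
    rw [this]
    ring
  have hlog : Complex.log (1 - r) = (Real.log (1 - r) : ℂ) := by
    rw [Complex.ofReal_log (by linarith)]
    push_cast
    rfl
  rw [hlog] at s2
  have s6 := ((Complex.hasSum_ofReal.2 s3).mul_left (x * Complex.I)).sub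
    ((Complex.hasSum_ofReal.2 s4).mul_left ((x : ℂ) ^ 2 / 2))
  have s7 := (s1.sub s2).sub s6
  have hb := s7.norm_le_of_bounded s5 ?_
  · refine le_trans (le_of_eq ?_) hb
    congr 1
    ring
  · intro k
    have hk : (k : ℂ) + 1 ≠ 0 := by exact_mod_cast Nat.succ_ne_zero k
    have e : ((r : ℂ) * Complex.exp (x * Complex.I)) ^ (k + 1) / ((k : ℂ) + 1)
        - (r : ℂ) ^ (k + 1) / ((k : ℂ) + 1)
        - (x * Complex.I * ((r ^ (k + 1) : ℝ) : ℂ)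
          - (x : ℂ) ^ 2 / 2 * ((((k : ℝ) + 1) * r ^ (k + 1) : ℝ) : ℂ))
        = ((r ^ (k + 1) / ((k : ℝ) + 1) : ℝ) : ℂ) *
          (Complex.exp ((((k : ℝ) + 1) * x : ℝ) * Complex.I)
            - (1 + (((k : ℝ) + 1) * x : ℝ) * Complex.I - (((k : ℝ) + 1) * x : ℝ) ^ 2 / 2)) := by
      rw [mul_pow, ← Complex.exp_nat_mul]
      push_cast
      have e2 : ((k : ℂ) + 1) * (x * Complex.I) = (k + 1) * x * Complex.I := by ring
      rw [e2]
      field_simp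
      ring
    rw [e, norm_mul, Complex.norm_real, Real.norm_of_nonneg (by positivity)]
    refine (mul_le_mul_of_nonneg_left (norm_exp_mul_I_sub_le _) (by positivity)).trans ?_
    rw [abs_mul, abs_of_nonneg (by positivity : (0 : ℝ) ≤ k + 1), mul_pow]
    calc r ^ (k + 1) / ((k : ℝ) + 1) * (4 * (((k : ℝ) + 1) ^ 3 * |x| ^ 3))
        = 4 * |x| ^ 3 * (((k : ℝ) + 1) * ((k : ℝ) + 1) * r ^ (k + 1)) := by field_simp
      _ ≤ _ := by gcongr; norm_num

theorem sum_exp_neg_le {a : ℝ} (ha : 0 < a) (X : ℕ) :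
    ∑ j ∈ Finset.range X, Real.exp (-((j + 1) * a)) ≤ 1 / a := by
  have h0 : Real.exp (-a) < 1 := Real.exp_lt_one_iff.2 (by linarith)
  have h := (hasSum_geometric_of_lt_one (Real.exp_pos (-a)).le h0).mul_left (Real.exp (-a))
  have e : ∀ j : ℕ, Real.exp (-(((j : ℝ) + 1) * a)) = Real.exp (-a) * Real.exp (-a) ^ j := by
    intro j
    rw [← Real.exp_nat_mul, ← Real.exp_add]
    congr 1
    ring
  simp only [e]
  refine (h.summable.sum_le_tsum _ fun j _ => by positivity).trans ?_
  rw [h.tsum_eq, ← div_eq_mul_inv, div_le_div_iff₀ (by linarith) ha]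
  have h1 := Real.add_one_le_exp a
  have h3 : Real.exp (-a) * Real.exp a = 1 := by rw [← Real.exp_add]; simp
  nlinarith [Real.exp_pos (-a)]

/-- From `s ≤ (1-e⁻ˢ)(1+s)` and `1+s ≤ 6e^{s/6}`. Cubing costs only `e^{s/2}`, so half of the decay
remains for summation over `j`. -/
theorem exp_neg_div_one_sub_exp_neg_pow_three_le {s : ℝ} (hs : 0 < s) :
    Real.exp (-s) / (1 - Real.exp (-s)) ^ 3 ≤ 216 * Real.exp (-(s / 2)) / s ^ 3 := by
  have h1 := Real.add_one_le_exp s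
  have h3 : Real.exp (-s) * Real.exp s = 1 := by rw [← Real.exp_add]; simp
  have h4 := Real.exp_pos (-s)
  have h5 : s ≤ (1 - Real.exp (-s)) * (6 * Real.exp (s / 6)) := by
    have h6 := Real.add_one_le_exp (s / 6)
    have h7 : 0 ≤ 1 - Real.exp (-s) := (one_sub_exp_neg_mem hs.le).1
    have h8 : s ≤ (1 - Real.exp (-s)) * (1 + s) := by nlinarith
    refine h8.trans (mul_le_mul_of_nonneg_left (by linarith) h7)
  have h9 : 0 < 1 - Real.exp (-s) := by
    have : Real.exp (-s) < 1 := Real.exp_lt_one_iff.2 (by linarith)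
    linarith
  rw [div_le_div_iff₀ (by positivity) (by positivity)]
  have h10 := pow_le_pow_left₀ hs.le h5 3
  have e : Real.exp (-s) * Real.exp (s / 6) ^ 3 = Real.exp (-(s / 2)) := by
    rw [← Real.exp_nat_mul, ← Real.exp_add]
    congr 1
    push_cast
    ring
  calc Real.exp (-s) * s ^ 3 ≤ Real.exp (-s) * ((1 - Real.exp (-s)) * (6 * Real.exp (s / 6))) ^ 3 := by
        gcongr
    _ = 216 * (Real.exp (-s) * Real.exp (s / 6) ^ 3) * (1 - Real.exp (-s)) ^ 3 := by ring
    _ = _ := by rw [e]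

/-- The logarithm of `∏_{j ≤ X} (1 - e^{-jv}) / (1 - e^{-jv + ijθ})`. -/
noncomputable def logFactorSum (v : ℝ) (X : ℕ) (θ : ℝ) : ℂ :=
  ∑ j ∈ Finset.range X,
    (-Complex.log (1 - (Real.exp (-((j + 1) * v)) : ℝ) * Complex.exp ((((j : ℝ) + 1) * θ : ℝ) * Complex.I))
      + (Real.log (1 - Real.exp (-((j + 1) * v))) : ℂ))

/-- In the cubic error of the `j`-th factor, `(j|θ|)³` meets `(jv)³` in the denominator, so `j`
survives only in `e^{-jv/2}`; the sum over `j` costs one further `2/v`. -/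
theorem norm_logFactorSum_sub_le {v : ℝ} (hv : 0 < v) (X : ℕ) (θ : ℝ) :
    ‖logFactorSum v X θ -
      (θ * (∑ j ∈ Finset.range X, ((j : ℝ) + 1) / (Real.exp ((j + 1) * v) - 1) : ℝ) * Complex.I
        - θ ^ 2 / 2 * (∑ j ∈ Finset.range X, ((j : ℝ) + 1) ^ 2 * Real.exp ((j + 1) * v) /
        (Real.exp ((j + 1) * v) - 1) ^ 2 : ℝ))‖ ≤ 3456 * |θ| ^ 3 / v ^ 4 := by
  have hterm : ∀ j ∈ Finset.range X,
      ‖-Complex.log (1 - (Real.exp (-((j + 1) * v)) : ℝ) * Complex.exp ((((j : ℝ) + 1) * θ : ℝ) * Complex.I))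
      + (Real.log (1 - Real.exp (-((j + 1) * v))) : ℂ) -
      (θ * (((j : ℝ) + 1) / (Real.exp ((j + 1) * v) - 1) : ℝ) * Complex.I
        - θ ^ 2 / 2 * (((j : ℝ) + 1) ^ 2 * Real.exp ((j + 1) * v) /
        (Real.exp ((j + 1) * v) - 1) ^ 2 : ℝ))‖ ≤
        1728 * |θ| ^ 3 / v ^ 3 * Real.exp (-((j + 1) * (v / 2))) := by
    intro j _
    have hs : 0 < ((j : ℝ) + 1) * v := by positivity
    have hr1 : Real.exp (-(((j : ℝ) + 1) * v)) < 1 := Real.exp_lt_one_iff.2 (by linarith)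
    have h := norm_log_factor_sub_le (Real.exp_pos _) hr1 (((j : ℝ) + 1) * θ)
    have h0 := exp_sub_one_pos hs
    have hE := Real.exp_pos (((j : ℝ) + 1) * v)
    have e1 : Real.exp (-(((j : ℝ) + 1) * v)) / (1 - Real.exp (-(((j : ℝ) + 1) * v))) =
        1 / (Real.exp (((j : ℝ) + 1) * v) - 1) := by
      rw [Real.exp_neg]
      field_simp
    have e2 : Real.exp (-(((j : ℝ) + 1) * v)) / (1 - Real.exp (-(((j : ℝ) + 1) * v))) ^ 2 =
        Real.exp (((j : ℝ) + 1) * v) / (Real.exp (((j : ℝ) + 1) * v) - 1) ^ 2 := by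
      have : 1 - (Real.exp (((j : ℝ) + 1) * v))⁻¹ ≠ 0 := by rw [← Real.exp_neg]; linarith
      rw [Real.exp_neg]
      field_simp
    rw [e1, e2] at h
    refine le_trans (le_of_eq ?_) (h.trans ?_)
    · congr 2
      push_cast
      ring
    · have h6 := exp_neg_div_one_sub_exp_neg_pow_three_le hs
      rw [abs_mul, abs_of_pos (by positivity : (0 : ℝ) < j + 1)]
      calc 8 * (((j : ℝ) + 1) * |θ|) ^ 3 * (Real.exp (-(((j : ℝ) + 1) * v)) /
            (1 - Real.exp (-(((j : ℝ) + 1) * v))) ^ 3)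
          ≤ 8 * (((j : ℝ) + 1) * |θ|) ^ 3 * (216 * Real.exp (-(((j : ℝ) + 1) * v / 2)) /
            (((j : ℝ) + 1) * v) ^ 3) := by gcongr
        _ = _ := by
          rw [mul_div_assoc]
          field_simp
          ring
  unfold logFactorSum
  have e : (θ * (∑ j ∈ Finset.range X, ((j : ℝ) + 1) / (Real.exp ((j + 1) * v) - 1) : ℝ) * Complex.I
        - θ ^ 2 / 2 * (∑ j ∈ Finset.range X, ((j : ℝ) + 1) ^ 2 * Real.exp ((j + 1) * v) /
        (Real.exp ((j + 1) * v) - 1) ^ 2 : ℝ) : ℂ) = ∑ j ∈ Finset.range X,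
        (θ * (((j : ℝ) + 1) / (Real.exp ((j + 1) * v) - 1) : ℝ) * Complex.I
        - θ ^ 2 / 2 * (((j : ℝ) + 1) ^ 2 * Real.exp ((j + 1) * v) /
        (Real.exp ((j + 1) * v) - 1) ^ 2 : ℝ)) := by
    rw [Finset.sum_sub_distrib, ← Finset.mul_sum, Complex.ofReal_sum, Complex.ofReal_sum,
      Finset.mul_sum, Finset.sum_mul]
  rw [e, ← Finset.sum_sub_distrib]
  refine (norm_sum_le_of_le _ hterm).trans ?_
  rw [← Finset.mul_sum]
  calc _ ≤ 1728 * |θ| ^ 3 / v ^ 3 * (1 / (v / 2)) := by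
        gcongr
        exact sum_exp_neg_le (by positivity) X
    _ = _ := by field_simp; ring

theorem exp_logFactorSum {v : ℝ} (hv : 0 < v) (X : ℕ) (θ : ℝ) :
    Complex.exp (logFactorSum v X θ) *
      ∏ j ∈ Finset.range X, (1 - Complex.exp (-v + θ * Complex.I) ^ (j + 1)) =
      ∏ j ∈ Finset.range X, (1 - (Real.exp (-v) : ℂ) ^ (j + 1)) := by
  unfold logFactorSum
  rw [Complex.exp_sum, ← Finset.prod_mul_distrib]
  refine Finset.prod_congr rfl fun j _ => ?_
  have hs : 0 < ((j : ℝ) + 1) * v := by positivity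
  have hr1 : Real.exp (-(((j : ℝ) + 1) * v)) < 1 := Real.exp_lt_one_iff.2 (by linarith)
  have e1 : Complex.exp (-v + θ * Complex.I) ^ (j + 1) =
      (Real.exp (-((j + 1) * v)) : ℝ) * Complex.exp ((((j : ℝ) + 1) * θ : ℝ) * Complex.I) := by
    rw [← Complex.exp_nat_mul, Complex.ofReal_exp, ← Complex.exp_add]
    congr 1
    push_cast
    ring
  have e2 : (Real.exp (-v) : ℂ) ^ (j + 1) = (Real.exp (-((j + 1) * v)) : ℝ) := by
    rw [← Complex.ofReal_pow, ← Real.exp_nat_mul]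
    congr 2
    push_cast
    ring
  rw [e1, e2, Complex.exp_add, Complex.exp_neg, Complex.exp_log, ← Complex.ofReal_exp,
    Real.exp_log (by linarith)]
  · have : (1 - (Real.exp (-((j + 1) * v)) : ℝ) * Complex.exp ((((j : ℝ) + 1) * θ : ℝ) * Complex.I) : ℂ) ≠ 0 := by
      intro h
      have h2 := congrArg norm (sub_eq_zero.1 h)
      rw [norm_mul, Complex.norm_exp_ofReal_mul_I, Complex.norm_real,
        Real.norm_of_nonneg (Real.exp_pos _).le] at h2
      simp at h2
      linarith
    rw [mul_right_comm, inv_mul_cancel₀ this]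
    push_cast
    ring
  · intro h
    have h2 := congrArg norm (sub_eq_zero.1 h)
    rw [norm_mul, Complex.norm_exp_ofReal_mul_I, Complex.norm_real,
      Real.norm_of_nonneg (Real.exp_pos _).le] at h2
    simp at h2
    linarith

/-! ### Decay of the integrand away from `θ = 0`. -/

/-- The relative excess `|1 - e^{-Jv + iJθ}|² / (1 - e^{-Jv})² - 1`. -/
noncomputable def sinRatio (v θ : ℝ) (J : ℕ) : ℝ :=
  Real.sin (J * θ / 2) ^ 2 / Real.sinh (J * v / 2) ^ 2

theorem sinRatio_nonneg (v θ : ℝ) (J : ℕ) : 0 ≤ sinRatio v θ J := by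
  unfold sinRatio
  positivity

theorem log_one_add_sinRatio_nonneg (v θ : ℝ) (J : ℕ) : 0 ≤ Real.log (1 + sinRatio v θ J) :=
  Real.log_nonneg (by linarith [sinRatio_nonneg v θ J])

/-- With `r = e^{-s}`: `|1 - re^{ix}|² = (1-r)² + 4r sin²(x/2)` and `(1-r)² = 4r sinh²(s/2)`. -/
theorem re_logFactorSum {v : ℝ} (hv : 0 < v) (X : ℕ) (θ : ℝ) :
    (logFactorSum v X θ).re = -(∑ j ∈ Finset.range X, Real.log (1 + sinRatio v θ (j + 1))) / 2 := by
  unfold logFactorSum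
  rw [Complex.re_sum, ← Finset.sum_neg_distrib, Finset.sum_div]
  refine Finset.sum_congr rfl fun j _ => ?_
  have hs : 0 < ((j : ℝ) + 1) * v := by positivity
  have hr1 : Real.exp (-(((j : ℝ) + 1) * v)) < 1 := Real.exp_lt_one_iff.2 (by linarith)
  rw [Complex.add_re, Complex.neg_re, Complex.log_re, Complex.ofReal_re]
  set r := Real.exp (-(((j : ℝ) + 1) * v)) with hr
  have hsinh : 0 < Real.sinh (((j : ℝ) + 1) * v / 2) := Real.sinh_pos_iff.2 (by linarith)
  have h1 : (1 - r) ^ 2 = 4 * r * Real.sinh (((j : ℝ) + 1) * v / 2) ^ 2 := by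
    have h := exp_sub_one_sq (((j : ℝ) + 1) * v)
    have h3 : r * Real.exp (((j : ℝ) + 1) * v) = 1 := by rw [hr, ← Real.exp_add]; simp
    calc (1 - r) ^ 2 = (r * Real.exp (((j : ℝ) + 1) * v) - r) ^ 2 := by rw [h3]
      _ = r ^ 2 * (Real.exp (((j : ℝ) + 1) * v) - 1) ^ 2 := by ring
      _ = 4 * r * Real.sinh (((j : ℝ) + 1) * v / 2) ^ 2 * (r * Real.exp (((j : ℝ) + 1) * v)) := by
        rw [h]; ring
      _ = _ := by rw [h3, mul_one]
  have h2 : ‖(1 - (r : ℂ) * Complex.exp ((((j : ℝ) + 1) * θ : ℝ) * Complex.I) : ℂ)‖ ^ 2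
      = (1 - r) ^ 2 * (1 + sinRatio v θ (j + 1)) := by
    rw [← Complex.normSq_eq_norm_sq, Complex.exp_mul_I, ← Complex.ofReal_cos, ← Complex.ofReal_sin,
      Complex.normSq_apply]
    simp only [Complex.sub_re, Complex.one_re, Complex.re_ofReal_mul, Complex.add_re,
      Complex.ofReal_re, Complex.mul_I_re, Complex.ofReal_im, Complex.sub_im, Complex.one_im,
      Complex.im_ofReal_mul, Complex.add_im, Complex.mul_I_im, neg_zero, add_zero, zero_add]
    have h4 : (1 - r) ^ 2 * sinRatio v θ (j + 1) = 4 * r * Real.sin (((j : ℝ) + 1) * θ / 2) ^ 2 := by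
      unfold sinRatio
      rw [h1]
      push_cast
      field_simp
    rw [mul_add, h4]
    have h5 : Real.cos (((j : ℝ) + 1) * θ) = 1 - 2 * Real.sin (((j : ℝ) + 1) * θ / 2) ^ 2 := by
      have := Real.cos_two_mul (((j : ℝ) + 1) * θ / 2)
      rw [mul_div_cancel₀ _ (two_ne_zero)] at this
      rw [this, Real.cos_sq']
      ring
    have h6 := Real.sin_sq_add_cos_sq (((j : ℝ) + 1) * θ)
    calc _ = 1 - 2 * r * Real.cos (((j : ℝ) + 1) * θ) + r ^ 2 *
          (Real.sin (((j : ℝ) + 1) * θ) ^ 2 + Real.cos (((j : ℝ) + 1) * θ) ^ 2) := by ring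
      _ = _ := by rw [h6, h5]; ring
  have h3 := congrArg Real.log h2
  have hpos : (0 : ℝ) < 1 + sinRatio v θ (j + 1) := by linarith [sinRatio_nonneg v θ (j + 1)]
  rw [Real.log_pow, Real.log_mul (by have : 0 < 1 - r := by linarith
                                     positivity) hpos.ne', Real.log_pow] at h3
  push_cast at h3 ⊢
  linarith

theorem exp_mul_sinh_le_sinh_add {A B : ℝ} (hA : 0 ≤ A) :
    Real.exp A * Real.sinh B ≤ Real.sinh (A + B) := by
  rw [Real.sinh_add, ← Real.cosh_add_sinh]
  have h1 : Real.sinh B ≤ Real.cosh B := (Real.sinh_lt_cosh B).le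
  nlinarith [Real.sinh_nonneg_iff.2 hA]

/-- Combine `sin²(x+y) ≤ 2(sin²x + sin²y)` with `sinh(A+B) ≥ e^A sinh B ≥ e^A sinh A`. Splitting an
index into halves thus gains an exponential factor. -/
theorem sinRatio_add_le {v : ℝ} (hv : 0 < v) (θ : ℝ) {a b : ℕ} (ha : 0 < a) (hab : a ≤ b) :
    sinRatio v θ (a + b) ≤ 2 * Real.exp (-(a * v)) * (sinRatio v θ a + sinRatio v θ b) := by
  have ha' : (0 : ℝ) < a := by exact_mod_cast ha
  have hab' : (a : ℝ) ≤ b := by exact_mod_cast hab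
  set A := (a : ℝ) * v / 2 with hA
  set B := (b : ℝ) * v / 2 with hB
  have hA0 : 0 < A := by positivity
  have hAB : A ≤ B := by rw [hA, hB]; gcongr
  have hsA := Real.sinh_pos_iff.2 hA0
  have hsB := Real.sinh_pos_iff.2 (hA0.trans_le hAB)
  have k1 : Real.exp A * Real.sinh B ≤ Real.sinh (A + B) := exp_mul_sinh_le_sinh_add hA0.le
  have k2 : Real.exp A * Real.sinh A ≤ Real.sinh (A + B) := by
    refine le_trans ?_ k1
    gcongr
    exact Real.sinh_le_sinh.2 hAB
  have hE : Real.exp (-(a * v)) = (Real.exp A ^ 2)⁻¹ := by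
    rw [← Real.exp_nat_mul, ← Real.exp_neg]
    congr 1
    rw [hA]
    push_cast
    ring
  have hsin : Real.sin (a * θ / 2 + b * θ / 2) ^ 2 ≤
      2 * (Real.sin (a * θ / 2) ^ 2 + Real.sin (b * θ / 2) ^ 2) := by
    rw [Real.sin_add]
    have c1 := Real.sin_sq_add_cos_sq (a * θ / 2)
    have c2 := Real.sin_sq_add_cos_sq (b * θ / 2)
    set p := Real.sin (a * θ / 2)
    set q := Real.cos (a * θ / 2)
    set s := Real.sin (b * θ / 2)
    set t := Real.cos (b * θ / 2)
    have d1 : (p * t) ^ 2 ≤ p ^ 2 := by nlinarith [mul_nonneg (sq_nonneg p) (sq_nonneg s)]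
    have d2 : (q * s) ^ 2 ≤ s ^ 2 := by nlinarith [mul_nonneg (sq_nonneg p) (sq_nonneg s)]
    nlinarith [sq_nonneg (p * t - q * s)]
  have e1 : ((a + b : ℕ) : ℝ) * θ / 2 = a * θ / 2 + b * θ / 2 := by push_cast; ring
  have e2 : ((a + b : ℕ) : ℝ) * v / 2 = A + B := by rw [hA, hB]; push_cast; ring
  unfold sinRatio
  rw [e1, e2, hE, ← hA, ← hB]
  have hEA := Real.exp_pos A
  have f1 : (Real.exp A ^ 2)⁻¹ * (Real.sin (a * θ / 2) ^ 2 / Real.sinh A ^ 2) =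
      Real.sin (a * θ / 2) ^ 2 / (Real.exp A * Real.sinh A) ^ 2 := by field_simp
  have f2 : (Real.exp A ^ 2)⁻¹ * (Real.sin (b * θ / 2) ^ 2 / Real.sinh B ^ 2) =
      Real.sin (b * θ / 2) ^ 2 / (Real.exp A * Real.sinh B) ^ 2 := by field_simp
  have hpos : 0 < Real.sinh (A + B) := lt_of_lt_of_le (by positivity) k2
  calc _ ≤ 2 * (Real.sin (a * θ / 2) ^ 2 + Real.sin (b * θ / 2) ^ 2) / Real.sinh (A + B) ^ 2 := by
        gcongr
    _ = 2 * (Real.sin (a * θ / 2) ^ 2 / Real.sinh (A + B) ^ 2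
          + Real.sin (b * θ / 2) ^ 2 / Real.sinh (A + B) ^ 2) := by ring
    _ ≤ 2 * (Real.sin (a * θ / 2) ^ 2 / (Real.exp A * Real.sinh A) ^ 2
          + Real.sin (b * θ / 2) ^ 2 / (Real.exp A * Real.sinh B) ^ 2) := by gcongr
    _ = _ := by rw [← f1, ← f2]; ring

theorem sum_comp_le_two_mul_sum {f : ℕ → ℝ} (hf : ∀ a, 0 ≤ f a) {S T : Finset ℕ} {φ : ℕ → ℕ}
    (hφ : ∀ J ∈ T, φ J ∈ S) (c : ℕ → ℕ) (hc : ∀ J ∈ T, J = c (φ J) ∨ J = c (φ J) + 1) :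
    ∑ J ∈ T, f (φ J) ≤ 2 * ∑ a ∈ S, f a := by
  rw [← Finset.sum_fiberwise_of_maps_to hφ, Finset.mul_sum]
  refine Finset.sum_le_sum fun a _ => ?_
  have h1 : ∑ J ∈ T with φ J = a, f (φ J) = ((T.filter fun J => φ J = a).card : ℝ) * f a := by
    rw [← nsmul_eq_mul, ← Finset.sum_const]
    exact Finset.sum_congr rfl fun J hJ => by rw [(Finset.mem_filter.1 hJ).2]
  rw [h1]
  refine mul_le_mul_of_nonneg_right ?_ (hf a)
  have h2 : (T.filter fun J => φ J = a) ⊆ {c a, c a + 1} := by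
    intro J hJ
    obtain ⟨h3, h4⟩ := Finset.mem_filter.1 hJ
    have := hc J h3
    rw [h4] at this
    simpa using this
  exact_mod_cast (Finset.card_le_card h2).trans Finset.card_le_two

theorem exp_two_point_four_ge : 10.9 ≤ Real.exp 2.4 := by
  have h1 : Real.exp 2.4 = Real.exp 1 ^ 2 * Real.exp 0.4 := by
    rw [← Real.exp_nat_mul, ← Real.exp_add]; norm_num
  have h2 := Real.exp_one_gt_d9
  have h3 := Real.quadratic_le_exp_of_nonneg (by norm_num : (0 : ℝ) ≤ 0.4)
  have h4 : (2.718 : ℝ) ^ 2 ≤ Real.exp 1 ^ 2 := by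
    refine pow_le_pow_left₀ (by norm_num) (by linarith) 2
  rw [h1]
  calc (10.9 : ℝ) ≤ 2.718 ^ 2 * (1 + 0.4 + 0.4 ^ 2 / 2) := by norm_num
    _ ≤ _ := by gcongr

/-- For `av ≥ 2.4` the ratio is at most 0.45, and `log(1+x) ≥ 2x/(x+2)` then loses only the factor
`1 + 0.45/2 = 1.225`. -/
theorem sinRatio_le_log {v : ℝ} (θ : ℝ) {a : ℕ} (ha : 2.4 ≤ a * v) :
    sinRatio v θ a ≤ 1.225 * Real.log (1 + sinRatio v θ a) := by
  have h0 := sinRatio_nonneg v θ a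
  have hE : 10.9 ≤ Real.exp (a * v) := exp_two_point_four_ge.trans (by gcongr)
  have hs := exp_sub_one_sq (a * v)
  have hsq : 2.225 ≤ Real.sinh (a * v / 2) ^ 2 := by
    by_contra! hlt
    nlinarith
  have h1 : sinRatio v θ a ≤ 0.45 := by
    unfold sinRatio
    rw [div_le_iff₀ (by linarith)]
    have := Real.sin_sq_le_one (a * θ / 2)
    nlinarith
  have h2 := Real.le_log_one_add_of_nonneg h0
  rw [div_le_iff₀ (by linarith)] at h2
  have h3 := log_one_add_sinRatio_nonneg v θ a
  nlinarith

/-- Each tail index is split as `J = ⌊J/2⌋ + ⌈J/2⌉`; both halves are at least `M/2`, where the gain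
is `e^{-2.4} ≤ 1/10.9`, and at most `N`. Each half index is hit at most twice by each of the two
maps, for a total constant `(2/10.9) * 4 * 1.225 < 0.9`. A constant below 1 is what lets the
denominator win. -/
theorem sum_log_tail_le {v : ℝ} (hv : 0 < v) (θ : ℝ) {M N : ℕ} (hMN : M ≤ N)
    (hM : 4.8 ≤ M * v) :
    ∑ J ∈ Finset.Ioc M (M + N), Real.log (1 + sinRatio v θ J) ≤
      0.9 * ∑ a ∈ Finset.Icc 1 N, Real.log (1 + sinRatio v θ a) := by
  have hM0 : 0 < M := by
    rcases Nat.eq_zero_or_pos M with rfl | h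
    · norm_num at hM
    · exact h
  set S := (Finset.Icc 1 N).filter fun a => M ≤ 2 * a with hS
  have hSa : ∀ a ∈ S, 2.4 ≤ a * v := by
    intro a ha
    have : M ≤ 2 * a := (Finset.mem_filter.1 ha).2
    have : (M : ℝ) ≤ 2 * a := by exact_mod_cast this
    nlinarith
  have hmem1 : ∀ J ∈ Finset.Ioc M (M + N), J / 2 ∈ S := by
    intro J hJ
    rw [Finset.mem_Ioc] at hJ
    rw [hS, Finset.mem_filter, Finset.mem_Icc]
    omega
  have hmem2 : ∀ J ∈ Finset.Ioc M (M + N), (J + 1) / 2 ∈ S := by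
    intro J hJ
    rw [Finset.mem_Ioc] at hJ
    rw [hS, Finset.mem_filter, Finset.mem_Icc]
    omega
  have hexp : Real.exp (-2.4) ≤ 1 / 10.9 := by
    rw [Real.exp_neg, ← one_div]
    exact one_div_le_one_div_of_le (by norm_num) exp_two_point_four_ge
  have hpt : ∀ J ∈ Finset.Ioc M (M + N), Real.log (1 + sinRatio v θ J) ≤
      2 / 10.9 * (sinRatio v θ (J / 2) + sinRatio v θ ((J + 1) / 2)) := by
    intro J hJ
    have h1 := hSa _ (hmem1 J hJ)
    have h3 : J / 2 + (J + 1) / 2 = J := by omega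
    have h4 := sinRatio_add_le hv θ (a := J / 2) (b := (J + 1) / 2)
      (by rw [Finset.mem_Ioc] at hJ; omega) (by omega)
    rw [h3] at h4
    have h5 := Real.log_le_sub_one_of_pos (x := 1 + sinRatio v θ J)
      (by linarith [sinRatio_nonneg v θ J])
    have h6 : Real.exp (-((J / 2 : ℕ) * v)) ≤ 1 / 10.9 :=
      (Real.exp_le_exp.2 (by linarith)).trans hexp
    have h7 := add_nonneg (sinRatio_nonneg v θ (J / 2)) (sinRatio_nonneg v θ ((J + 1) / 2))
    calc _ ≤ sinRatio v θ J := by linarith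
      _ ≤ _ := h4
      _ ≤ 2 * (1 / 10.9) * (sinRatio v θ (J / 2) + sinRatio v θ ((J + 1) / 2)) := by gcongr
      _ = _ := by ring
  refine (Finset.sum_le_sum hpt).trans ?_
  rw [← Finset.mul_sum, Finset.sum_add_distrib]
  have k1 := sum_comp_le_two_mul_sum (sinRatio_nonneg v θ) hmem1 (fun a => 2 * a)
    (fun J _ => by omega)
  -- The fibre of `J ↦ (J+1)/2` over `a` is contained in `{2a-1, 2a}`; positivity of `J` makes the
  -- truncated subtraction harmless.
  have k2 := sum_comp_le_two_mul_sum (sinRatio_nonneg v θ) hmem2 (fun a => 2 * a - 1)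
    (fun J hJ => by rw [Finset.mem_Ioc] at hJ; omega)
  have k3 : ∑ a ∈ S, sinRatio v θ a ≤ 1.225 * ∑ a ∈ S, Real.log (1 + sinRatio v θ a) := by
    rw [Finset.mul_sum]
    exact Finset.sum_le_sum fun a ha => sinRatio_le_log θ (hSa a ha)
  have k4 : ∑ a ∈ S, Real.log (1 + sinRatio v θ a) ≤
      ∑ a ∈ Finset.Icc 1 N, Real.log (1 + sinRatio v θ a) :=
    Finset.sum_le_sum_of_subset_of_nonneg (Finset.filter_subset _ _)
      fun a _ _ => log_one_add_sinRatio_nonneg v θ a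
  have k5 : 0 ≤ ∑ a ∈ Finset.Icc 1 N, Real.log (1 + sinRatio v θ a) :=
    Finset.sum_nonneg fun a _ => log_one_add_sinRatio_nonneg v θ a
  norm_num at *
  linarith

/-- Two indices at distance `m` cannot both have a small sine, because `mθ/2` is the difference of
their angles. Summing over `K` such pairs uses each index at most twice. -/
theorem sum_sin_sq_ge (θ : ℝ) (K m : ℕ) :
    K * Real.sin (m * θ / 2) ^ 2 / 4 ≤
      ∑ a ∈ Finset.Icc 1 (K + m), Real.sin (a * θ / 2) ^ 2 := by
  have hpt : ∀ a : ℕ, Real.sin (m * θ / 2) ^ 2 ≤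
      2 * (Real.sin (a * θ / 2) ^ 2 + Real.sin ((a + m : ℕ) * θ / 2) ^ 2) := by
    intro a
    have e : (m : ℝ) * θ / 2 = (a + m : ℕ) * θ / 2 - a * θ / 2 := by push_cast; ring
    rw [e, Real.sin_sub]
    have c1 := Real.sin_sq_add_cos_sq (a * θ / 2)
    have c2 := Real.sin_sq_add_cos_sq ((a + m : ℕ) * θ / 2)
    set p := Real.sin ((a + m : ℕ) * θ / 2)
    set q := Real.cos ((a + m : ℕ) * θ / 2)
    set s := Real.sin (a * θ / 2)
    set t := Real.cos (a * θ / 2)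
    have d1 : (p * t) ^ 2 ≤ p ^ 2 := by nlinarith [mul_nonneg (sq_nonneg p) (sq_nonneg s)]
    have d2 : (q * s) ^ 2 ≤ s ^ 2 := by nlinarith [mul_nonneg (sq_nonneg p) (sq_nonneg s)]
    nlinarith [sq_nonneg (p * t + q * s)]
  have h1 : K * Real.sin (m * θ / 2) ^ 2 ≤ ∑ a ∈ Finset.Icc 1 K,
      2 * (Real.sin (a * θ / 2) ^ 2 + Real.sin ((a + m : ℕ) * θ / 2) ^ 2) := by
    calc _ = ∑ a ∈ Finset.Icc 1 K, Real.sin (m * θ / 2) ^ 2 := by simp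
      _ ≤ _ := Finset.sum_le_sum fun a _ => hpt a
  rw [← Finset.mul_sum, Finset.sum_add_distrib] at h1
  have h2 : ∑ a ∈ Finset.Icc 1 K, Real.sin (a * θ / 2) ^ 2 ≤
      ∑ a ∈ Finset.Icc 1 (K + m), Real.sin (a * θ / 2) ^ 2 :=
    Finset.sum_le_sum_of_subset_of_nonneg (Finset.Icc_subset_Icc_right (by omega))
      fun _ _ _ => sq_nonneg _
  have h3 : ∑ a ∈ Finset.Icc 1 K, Real.sin ((a + m : ℕ) * θ / 2) ^ 2 ≤
      ∑ a ∈ Finset.Icc 1 (K + m), Real.sin (a * θ / 2) ^ 2 := by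
    rw [← Finset.sum_image (s := Finset.Icc 1 K) (g := fun a => a + m)
      (f := fun a : ℕ => Real.sin (a * θ / 2) ^ 2) (fun a _ b _ h => by simpa using h)]
    refine Finset.sum_le_sum_of_subset_of_nonneg ?_ fun _ _ _ => sq_nonneg _
    intro a ha
    simp only [Finset.mem_image, Finset.mem_Icc] at ha ⊢
    obtain ⟨b, hb, rfl⟩ := ha
    omega
  linarith

theorem two_div_pi_ge : 0.636 ≤ 2 / Real.pi := by
  rw [le_div_iff₀ Real.pi_pos]
  have := Real.pi_lt_d4
  nlinarith

theorem sum_sin_sq_ge_min {v θ : ℝ} (hv : 0 < v) (hv4 : v ≤ 1 / 4) (hθ0 : 0 < θ) (hθ : θ ≤ Real.pi) :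
    1 / 100 * min (1 / v) (θ ^ 2 / v ^ 3) ≤
      ∑ a ∈ Finset.Icc 1 ⌊3 / v⌋₊, Real.sin (a * θ / 2) ^ 2 := by
  have hv4' : 4 ≤ 1 / v := by rw [le_div_iff₀ hv]; linarith
  have hJ := Nat.lt_floor_add_one (3 / v)
  have h3v : 3 / v = 3 * (1 / v) := by ring
  have hpi := two_div_pi_ge
  rcases le_total θ v with hle | hle
  · refine (mul_le_mul_of_nonneg_left (min_le_right _ _) (by norm_num)).trans ?_
    -- Small `θ`: the longest shift of order `1/v`, with `mθ ≤ 1`, makes `sin(mθ/2)` of order `θ/v`.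
    set m := ⌊1 / v⌋₊ with hm
    have hm1 := Nat.lt_floor_add_one (1 / v)
    have hm2 := Nat.floor_le (by positivity : 0 ≤ 1 / v)
    have hmJ : m ≤ ⌊3 / v⌋₊ := Nat.floor_le_floor (by rw [h3v]; linarith)
    obtain ⟨K, hK⟩ := Nat.exists_eq_add_of_le' hmJ
    rw [hK]
    refine le_trans ?_ (sum_sin_sq_ge θ K m)
    have hKr : (⌊3 / v⌋₊ : ℝ) = K + m := by exact_mod_cast hK
    have hK1 : 1 / v ≤ K := by linarith
    have hmv : (m : ℝ) * v ≤ 1 := by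
      have := mul_le_mul_of_nonneg_right hm2 hv.le
      rwa [div_mul_cancel₀ _ hv.ne'] at this
    have hmθ : (m : ℝ) * θ ≤ 1 := le_trans (by gcongr) hmv
    have hm3 : 3 / 4 * (1 / v) ≤ m := by linarith
    have hsin := Real.mul_le_sin (x := m * θ / 2) (by positivity) (by linarith [Real.pi_gt_three])
    have hs2 : 0.23 * (θ / v) ≤ Real.sin (m * θ / 2) := by
      refine le_trans ?_ hsin
      calc 0.23 * (θ / v) ≤ 0.636 * (3 / 4 * (1 / v) * θ / 2) := by
            have : 0 ≤ θ / v := by positivity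
            have e : 0.636 * (3 / 4 * (1 / v) * θ / 2) = 0.2385 * (θ / v) := by ring
            rw [e]
            linarith
        _ ≤ _ := by gcongr
    have hs3 := pow_le_pow_left₀ (by positivity) hs2 2
    calc 1 / 100 * (θ ^ 2 / v ^ 3) ≤ 1 / v * (0.23 * (θ / v)) ^ 2 / 4 := by
          have e : 1 / v * (0.23 * (θ / v)) ^ 2 / 4 = 0.013225 * (θ ^ 2 / v ^ 3) := by
            field_simp; norm_num
          rw [e]
          have : 0 ≤ θ ^ 2 / v ^ 3 := by positivity
          linarith
      _ ≤ _ := by gcongr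
  · refine (mul_le_mul_of_nonneg_left (min_le_left _ _) (by norm_num)).trans ?_
    -- Large `θ`: this shift puts `mθ/2` in `[1/2, (1+π)/2]`, away from 0 and `π`, so the sine is
    -- bounded below.
    set m := ⌈1 / θ⌉₊ with hm
    have hm1 := Nat.le_ceil (1 / θ)
    have hm2 := Nat.ceil_lt_add_one (by positivity : 0 ≤ 1 / θ)
    have hθv : 1 / θ ≤ 1 / v := one_div_le_one_div_of_le hv hle
    have hmJ : m ≤ ⌊3 / v⌋₊ := by
      have : (m : ℝ) < ⌊3 / v⌋₊ := by linarith
      exact_mod_cast this.le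
    obtain ⟨K, hK⟩ := Nat.exists_eq_add_of_le' hmJ
    rw [hK]
    refine le_trans ?_ (sum_sin_sq_ge θ K m)
    have hKr : (⌊3 / v⌋₊ : ℝ) = K + m := by exact_mod_cast hK
    have hK1 : 1 / v ≤ K := by linarith
    have hmθ1 : 1 ≤ (m : ℝ) * θ := by
      have := mul_le_mul_of_nonneg_right hm1 hθ0.le
      rwa [div_mul_cancel₀ _ hθ0.ne'] at this
    have hmθ2 : (m : ℝ) * θ ≤ 1 + θ := by
      have := mul_le_mul_of_nonneg_right hm2.le hθ0.le
      rwa [add_mul, one_mul, div_mul_cancel₀ _ hθ0.ne'] at this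
    have hs2 : 0.3 ≤ Real.sin (m * θ / 2) := by
      rcases le_total (m * θ / 2) (Real.pi / 2) with h | h
      · have := Real.mul_le_sin (x := m * θ / 2) (by positivity) h
        nlinarith
      · have := Real.mul_le_sin (x := Real.pi - m * θ / 2) (by linarith [Real.pi_gt_three]) (by linarith)
        rw [Real.sin_pi_sub] at this
        have h2 : 1 / 2 ≤ Real.pi - m * θ / 2 := by linarith [Real.pi_gt_three]
        nlinarith
    have hs3 := pow_le_pow_left₀ (by positivity) hs2 2
    calc 1 / 100 * (1 / v) ≤ 1 / v * 0.3 ^ 2 / 4 := by linarith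
      _ ≤ _ := by gcongr

/-- Only indices `a ≤ 3/v` are kept: there `sinh²(av/2) ≤ 6`, so each logarithm is at least
`sin²(aθ/2)/7`. -/
theorem sum_log_one_add_sinRatio_ge {v θ : ℝ} (hv : 0 < v) (hv4 : v ≤ 1 / 4) (hθ0 : 0 < θ)
    (hθ : θ ≤ Real.pi) {N : ℕ} (hN : 4.8 ≤ N * v) :
    1 / 700 * min (1 / v) (θ ^ 2 / v ^ 3) ≤
      ∑ a ∈ Finset.Icc 1 N, Real.log (1 + sinRatio v θ a) := by
  have hJN : ⌊3 / v⌋₊ ≤ N := by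
    refine Nat.floor_le_of_le ?_
    rw [div_le_iff₀ hv]
    linarith
  refine le_trans ?_ (Finset.sum_le_sum_of_subset_of_nonneg (Finset.Icc_subset_Icc_right hJN)
    fun a _ _ => log_one_add_sinRatio_nonneg v θ a)
  have hpt : ∀ a ∈ Finset.Icc 1 ⌊3 / v⌋₊, Real.sin (a * θ / 2) ^ 2 / 7 ≤
      Real.log (1 + sinRatio v θ a) := by
    intro a ha
    rw [Finset.mem_Icc] at ha
    have ha1 : (0 : ℝ) < a := by exact_mod_cast ha.1
    have ha2 : (a : ℝ) * v ≤ 3 := by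
      have : (a : ℝ) ≤ ⌊3 / v⌋₊ := by exact_mod_cast ha.2
      have := this.trans (Nat.floor_le (by positivity))
      rwa [le_div_iff₀ hv] at this
    have hsinh : 0 < Real.sinh (a * v / 2) := Real.sinh_pos_iff.2 (by positivity)
    have h1 : Real.sinh (a * v / 2) ^ 2 ≤ 6 := by
      have e : Real.sinh (a * v / 2) ≤ Real.exp (a * v / 2) / 2 := by
        rw [Real.sinh_eq]
        linarith [Real.exp_pos (-(a * v / 2))]
      have e2 := pow_le_pow_left₀ hsinh.le e 2
      have e3 : Real.exp (a * v / 2) ^ 2 = Real.exp (a * v) := by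
        rw [← Real.exp_nat_mul]; congr 1; push_cast; ring
      have e4 : Real.exp (a * v) ≤ Real.exp 1 ^ 3 := by
        rw [← Real.exp_nat_mul]
        exact Real.exp_le_exp.2 (by push_cast; linarith)
      have e5 : Real.exp 1 ^ 3 ≤ 24 := by
        refine (pow_le_pow_left₀ (Real.exp_pos 1).le
          (by linarith [Real.exp_one_lt_d9] : Real.exp 1 ≤ 2.72) 3).trans (by norm_num)
      rw [div_pow, e3] at e2
      linarith
    set s := Real.sin (a * θ / 2) ^ 2 with hs
    have hs0 : 0 ≤ s := sq_nonneg _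
    have hs1 : s ≤ 1 := Real.sin_sq_le_one _
    have h2 : s / 6 ≤ sinRatio v θ a := by
      unfold sinRatio
      gcongr
    have h3 := Real.le_log_one_add_of_nonneg (by positivity : 0 ≤ s / 6)
    have h4 : s / 7 ≤ 2 * (s / 6) / (s / 6 + 2) := by
      rw [div_le_div_iff₀ (by norm_num) (by positivity)]
      nlinarith
    exact h4.trans (h3.trans (Real.log_le_log (by positivity) (by linarith)))
  refine le_trans ?_ (Finset.sum_le_sum hpt)
  rw [← Finset.sum_div]
  have := sum_sin_sq_ge_min hv hv4 hθ0 hθ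
  linarith

theorem sinRatio_abs (v θ : ℝ) (J : ℕ) : sinRatio v |θ| J = sinRatio v θ J := by
  rcases abs_choice θ with h | h
  · rw [h]
  · unfold sinRatio
    rw [h, mul_neg, neg_div, Real.sin_neg, neg_sq]

/-- For `M ≤ N` the sums up to `M` cancel, which leaves minus half of the sum over `a ≤ N` less the
tail. The tail takes at most 0.9 of it, and `(0.1/2) * (1/700) = 1/14000`. -/
theorem re_logFactorSum_le {v θ : ℝ} (hv : 0 < v) (hv4 : v ≤ 1 / 4) (hθ0 : θ ≠ 0)
    (hθ : |θ| ≤ Real.pi) {N M : ℕ} (hN : 4.8 ≤ N * v) (hM : 4.8 ≤ M * v) :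
    (logFactorSum v N θ + logFactorSum v M θ - logFactorSum v (N + M) θ).re ≤
      -(1 / 14000 * min (1 / v) (θ ^ 2 / v ^ 3)) := by
  wlog hMN : M ≤ N generalizing N M
  · have := this hM hN (le_of_not_ge hMN)
    rwa [add_comm (logFactorSum v M θ), add_comm M N] at this
  have hrange : ∀ X : ℕ, ∑ j ∈ Finset.range X, Real.log (1 + sinRatio v θ (j + 1)) =
      ∑ a ∈ Finset.Icc 1 X, Real.log (1 + sinRatio v θ a) := by
    intro X
    rw [Finset.range_eq_Ico, Finset.sum_Ico_add' (fun a => Real.log (1 + sinRatio v θ a)) 0 X 1]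
    rfl
  have hsplit : ∑ a ∈ Finset.Icc 1 (M + N), Real.log (1 + sinRatio v θ a) =
      ∑ a ∈ Finset.Icc 1 M, Real.log (1 + sinRatio v θ a) +
      ∑ a ∈ Finset.Ioc M (M + N), Real.log (1 + sinRatio v θ a) := by
    rw [← Finset.sum_union]
    · congr 1
      ext a
      simp only [Finset.mem_union, Finset.mem_Icc, Finset.mem_Ioc]
      omega
    · rw [Finset.disjoint_left]
      intro a ha
      simp only [Finset.mem_Icc, Finset.mem_Ioc] at *
      omega
  have h1 := sum_log_tail_le hv θ hMN hM
  have h2 := sum_log_one_add_sinRatio_ge hv hv4 (abs_pos.2 hθ0) hθ hN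
  simp only [sinRatio_abs, sq_abs] at h2
  rw [Complex.sub_re, Complex.add_re, re_logFactorSum hv, re_logFactorSum hv, re_logFactorSum hv,
    hrange, hrange, hrange, add_comm N M, hsplit]
  linarith

/-! ### The Gaussian binomial as generating function. -/

theorem restrictedPartitionCount_eq_ite {n N M : ℕ} (h : N = 0 ∨ M = 0) :
    restrictedPartitionCount n N M = if n = 0 then 1 else 0 := by
  unfold restrictedPartitionCount
  have hp : ∀ p : n.Partition, (∀ i ∈ p.parts, i ≤ N) ∧ p.parts.card ≤ M → p.parts = 0 := by
    intro p ⟨h1, h2⟩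
    rcases h with rfl | rfl
    · refine Multiset.eq_zero_of_forall_notMem fun i hi => ?_
      have := h1 i hi
      have := p.parts_pos hi
      omega
    · exact Multiset.card_eq_zero.1 (by omega)
  split_ifs with hn
  · subst hn
    rw [Finset.card_eq_one]
    refine ⟨default, ?_⟩
    ext p
    simp only [Finset.mem_filter, Finset.mem_univ, true_and, Finset.mem_singleton]
    exact ⟨fun _ => Subsingleton.elim _ _, fun _ => by simp⟩
  · rw [Finset.card_eq_zero, Finset.filter_eq_empty_iff]
    intro p _ h
    have := hp p h
    have h2 := p.parts_sum
    rw [this] at h2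
    exact hn (by simpa using h2.symm)

/-- Partitions are split according to whether the maximal allowed part `N + 1` occurs; if it does,
one copy is removed. -/
theorem restrictedPartitionCount_succ_succ (n N M : ℕ) :
    restrictedPartitionCount n (N + 1) (M + 1) = restrictedPartitionCount n N (M + 1) +
      if N + 1 ≤ n then restrictedPartitionCount (n - (N + 1)) (N + 1) M else 0 := by
  unfold restrictedPartitionCount
  rw [← Finset.card_filter_add_card_filter_not (p := fun p : n.Partition => N + 1 ∉ p.parts),
    Finset.filter_filter, Finset.filter_filter]
  congr 1
  · congr 1
    ext p
    simp only [Finset.mem_filter, Finset.mem_univ, true_and]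
    constructor
    · rintro ⟨⟨h1, h2⟩, h3⟩
      refine ⟨fun i hi => ?_, h2⟩
      have := h1 i hi
      have : i ≠ N + 1 := fun h => h3 (h ▸ hi)
      omega
    · rintro ⟨h1, h2⟩
      refine ⟨⟨fun i hi => (h1 i hi).trans (Nat.le_succ N), h2⟩, fun h => ?_⟩
      have := h1 _ h
      omega
  · split_ifs with hn
    · refine Finset.card_bij'
        (fun p hp => Nat.Partition.partitionWithPartEquiv (Nat.succ_le_succ (Nat.zero_le N)) hn
          ⟨p, not_not.1 (Finset.mem_filter.1 hp).2.2⟩)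
        (fun q _ => ((Nat.Partition.partitionWithPartEquiv (Nat.succ_le_succ (Nat.zero_le N)) hn).symm q).1)
        ?_ ?_ ?_ ?_
      · intro p hp
        simp only [Finset.mem_filter, Finset.mem_univ, true_and, not_not,
          Nat.Partition.partitionWithPartEquiv_apply_parts] at hp ⊢
        refine ⟨fun i hi => hp.1.1 i (Multiset.mem_of_mem_erase hi), ?_⟩
        rw [Multiset.card_erase_of_mem hp.2, Nat.pred_eq_sub_one]
        have := hp.1.2
        omega
      · intro q hq
        simp only [Finset.mem_filter, Finset.mem_univ, true_and, not_not,
          Nat.Partition.partitionWithPartEquiv_symm_apply_parts] at hq ⊢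
        refine ⟨⟨fun i hi => ?_, ?_⟩, by simp⟩
        · rcases Multiset.mem_cons.1 hi with rfl | hi
          · exact le_rfl
          · exact hq.1 i hi
        · simpa using hq.2
      · intro p hp
        simp
      · intro q hq
        simp
    · rw [Finset.card_eq_zero, Finset.filter_eq_empty_iff]
      rintro p _ ⟨-, h⟩
      exact hn (Nat.Partition.le_of_mem_parts (not_not.1 h))

open Polynomial in
/-- The Gaussian binomial coefficient `[N + M choose N]_q` as a polynomial. -/
noncomputable def gaussPoly : ℕ → ℕ → ℂ[X]
  | 0, _ => 1
  | _ + 1, 0 => 1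
  | N + 1, M + 1 => gaussPoly N (M + 1) + X ^ (N + 1) * gaussPoly (N + 1) M

open Polynomial in
theorem gaussPoly_zero_right (N : ℕ) : gaussPoly N 0 = 1 := by
  cases N <;> simp [gaussPoly]

open Polynomial in
theorem coeff_gaussPoly (n N M : ℕ) :
    (gaussPoly N M).coeff n = (restrictedPartitionCount n N M : ℂ) := by
  induction N generalizing n M with
  | zero =>
    rw [restrictedPartitionCount_eq_ite (Or.inl rfl), gaussPoly, coeff_one]
    split_ifs <;> simp
  | succ N ihN =>
    induction M generalizing n with
    | zero =>
      rw [restrictedPartitionCount_eq_ite (Or.inr rfl), gaussPoly_zero_right, coeff_one]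
      split_ifs <;> simp
    | succ M ihM =>
      rw [gaussPoly, coeff_add, coeff_X_pow_mul', ihN, restrictedPartitionCount_succ_succ]
      split_ifs with h
      · rw [ihM]; push_cast; rfl
      · simp

/-- The product formula is kept cross-multiplied, so that it holds also at roots of unity. -/
theorem eval_gaussPoly (z : ℂ) (N M : ℕ) :
    (gaussPoly N M).eval z * ((∏ j ∈ Finset.range N, (1 - z ^ (j + 1))) *
      ∏ j ∈ Finset.range M, (1 - z ^ (j + 1))) = ∏ j ∈ Finset.range (N + M), (1 - z ^ (j + 1)) := by
  induction N generalizing M with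
  | zero => simp [gaussPoly]
  | succ N ihN =>
    induction M with
    | zero => simp [gaussPoly]
    | succ M ihM =>
      have h1 := ihN (M + 1)
      rw [show N + (M + 1) = N + 1 + M by ring] at h1
      rw [gaussPoly, Polynomial.eval_add, Polynomial.eval_mul, Polynomial.eval_pow,
        Polynomial.eval_X, show N + 1 + (M + 1) = N + 1 + M + 1 by ring,
        Finset.prod_range_succ _ (N + 1 + M)]
      set P := ∏ j ∈ Finset.range (N + 1 + M), (1 - z ^ (j + 1))
      -- The induction rests on `1 - z^{N+M+2} = (1 - z^{N+1}) + z^{N+1}(1 - z^{M+1})`.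
      calc _ = (gaussPoly N (M + 1)).eval z * ((∏ j ∈ Finset.range N, (1 - z ^ (j + 1))) *
              ∏ j ∈ Finset.range (M + 1), (1 - z ^ (j + 1))) * (1 - z ^ (N + 1)) +
            (gaussPoly (N + 1) M).eval z * ((∏ j ∈ Finset.range (N + 1), (1 - z ^ (j + 1))) *
              ∏ j ∈ Finset.range M, (1 - z ^ (j + 1))) * (z ^ (N + 1) * (1 - z ^ (M + 1))) := by
            rw [Finset.prod_range_succ _ N, Finset.prod_range_succ _ M]
            ring
        _ = _ := by
            rw [h1, ihM]
            ring

/-! ### Cauchy's coefficient formula on the circle `|z| = e^{-v}`. -/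

theorem integral_exp_int_mul_I (k : ℤ) :
    ∫ θ in -Real.pi..Real.pi, Complex.exp (k * θ * Complex.I) = if k = 0 then 2 * Real.pi else 0 := by
  split_ifs with hk
  · subst hk
    simp
    ring
  · have hc : (k * Complex.I : ℂ) ≠ 0 := mul_ne_zero (by exact_mod_cast hk) Complex.I_ne_zero
    have e : ∀ θ : ℝ, Complex.exp (k * θ * Complex.I) = Complex.exp (k * Complex.I * θ) := by
      intro θ; congr 1; ring
    simp only [e]
    rw [integral_exp_mul_complex hc]
    have h : Complex.exp (k * Complex.I * Real.pi) = Complex.exp (k * Complex.I * (-Real.pi : ℝ)) := by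
      rw [Complex.exp_eq_exp_iff_exists_int]
      exact ⟨k, by push_cast; ring⟩
    rw [h]
    simp

theorem integral_eval_eq_coeff (P : Polynomial ℂ) (v : ℝ) (n : ℕ) :
    ∫ θ in -Real.pi..Real.pi, P.eval (Complex.exp (-v + θ * Complex.I)) *
      Complex.exp (n * v - n * θ * Complex.I) = 2 * Real.pi * P.coeff n := by
  have e : ∀ θ : ℝ, P.eval (Complex.exp (-v + θ * Complex.I)) *
      Complex.exp (n * v - n * θ * Complex.I) = ∑ k ∈ P.support,
        P.coeff k * Complex.exp ((n - k) * v) * Complex.exp (((k : ℤ) - (n : ℤ) : ℤ) * θ * Complex.I) := by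
    intro θ
    rw [Polynomial.eval_eq_sum, Polynomial.sum_def, Finset.sum_mul]
    refine Finset.sum_congr rfl fun k _ => ?_
    rw [← Complex.exp_nat_mul, mul_assoc, ← Complex.exp_add,
      mul_assoc (P.coeff k) (Complex.exp ((n - k) * v)), ← Complex.exp_add]
    congr 2
    push_cast
    ring
  simp only [e]
  rw [intervalIntegral.integral_finsetSum]
  · have e2 : ∀ k ∈ P.support, ∫ θ in -Real.pi..Real.pi, P.coeff k * Complex.exp ((n - k) * v) *
        Complex.exp (((k : ℤ) - (n : ℤ) : ℤ) * θ * Complex.I) =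
        if k = n then 2 * Real.pi * P.coeff n else 0 := by
      intro k _
      rw [intervalIntegral.integral_const_mul, integral_exp_int_mul_I]
      by_cases hk : k = n
      · subst hk
        simp
        ring
      · rw [if_neg hk, if_neg (by omega), Complex.ofReal_zero, mul_zero]
    rw [Finset.sum_congr rfl e2, Finset.sum_ite_eq']
    split_ifs with h
    · rfl
    · rw [Polynomial.notMem_support_iff.1 h, mul_zero]
  · intro k _
    exact Continuous.intervalIntegrable (by fun_prop) _ _

/-- The Cauchy integral for the coefficients of the Gaussian binomial, normalised by its value at
the saddle point `e^{-v}`. -/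
theorem restrictedPartitionCount_eq_integral {v : ℝ} (hv : 0 < v) (n N M : ℕ) :
    (restrictedPartitionCount n N M : ℂ) =
      Real.exp (∑ j ∈ Finset.range (N + M), Real.log (1 - Real.exp (-((j + 1) * v)))
        - ∑ j ∈ Finset.range N, Real.log (1 - Real.exp (-((j + 1) * v)))
        - ∑ j ∈ Finset.range M, Real.log (1 - Real.exp (-((j + 1) * v))) + n * v) / (2 * Real.pi) *
      ∫ θ in -Real.pi..Real.pi, Complex.exp (logFactorSum v N θ + logFactorSum v M θ
        - logFactorSum v (N + M) θ - n * θ * Complex.I) := by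
  have hprod : ∀ X : ℕ, (∏ j ∈ Finset.range X, (1 - (Real.exp (-v) : ℂ) ^ (j + 1))) =
      Real.exp (∑ j ∈ Finset.range X, Real.log (1 - Real.exp (-((j + 1) * v)))) := by
    intro X
    rw [Real.exp_sum, Complex.ofReal_prod]
    refine Finset.prod_congr rfl fun j _ => ?_
    have hr1 : Real.exp (-(((j : ℝ) + 1) * v)) < 1 := Real.exp_lt_one_iff.2 (by
      have : 0 < ((j : ℝ) + 1) * v := by positivity
      linarith)
    have e2 : (Real.exp (-v) : ℂ) ^ (j + 1) = (Real.exp (-((j + 1) * v)) : ℝ) := by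
      rw [← Complex.ofReal_pow, ← Real.exp_nat_mul]
      congr 2
      push_cast
      ring
    rw [e2, Real.exp_log (by linarith)]
    push_cast
    rfl
  have h1 := integral_eval_eq_coeff (gaussPoly N M) v n
  rw [coeff_gaussPoly] at h1
  have hpi : (Real.pi : ℂ) ≠ 0 := by exact_mod_cast Real.pi_ne_zero
  have key : ∀ θ : ℝ, (gaussPoly N M).eval (Complex.exp (-v + θ * Complex.I)) *
      Complex.exp (n * v - n * θ * Complex.I) =
      Real.exp (∑ j ∈ Finset.range (N + M), Real.log (1 - Real.exp (-((j + 1) * v)))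
        - ∑ j ∈ Finset.range N, Real.log (1 - Real.exp (-((j + 1) * v)))
        - ∑ j ∈ Finset.range M, Real.log (1 - Real.exp (-((j + 1) * v))) + n * v) *
      Complex.exp (logFactorSum v N θ + logFactorSum v M θ
        - logFactorSum v (N + M) θ - n * θ * Complex.I) := by
    intro θ
    have g := eval_gaussPoly (Complex.exp (-v + θ * Complex.I)) N M
    have a1 := exp_logFactorSum hv N θ
    have a2 := exp_logFactorSum hv M θ
    have a3 := exp_logFactorSum hv (N + M) θ
    rw [hprod] at a1 a2 a3
    set P1 := ∏ j ∈ Finset.range N, (1 - Complex.exp (-v + θ * Complex.I) ^ (j + 1))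
    set P2 := ∏ j ∈ Finset.range M, (1 - Complex.exp (-v + θ * Complex.I) ^ (j + 1))
    set P3 := ∏ j ∈ Finset.range (N + M), (1 - Complex.exp (-v + θ * Complex.I) ^ (j + 1))
    have n1 : P1 ≠ 0 := by
      intro h
      rw [h, mul_zero] at a1
      exact Complex.ofReal_ne_zero.2 (Real.exp_pos _).ne' a1.symm
    have n2 : P2 ≠ 0 := by
      intro h
      rw [h, mul_zero] at a2
      exact Complex.ofReal_ne_zero.2 (Real.exp_pos _).ne' a2.symm
    rw [← eq_div_iff (mul_ne_zero n1 n2)] at g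
    have b1 := eq_div_of_mul_eq n1 a1
    have b2 := eq_div_of_mul_eq n2 a2
    have n3 := Complex.exp_ne_zero (logFactorSum v (N + M) θ)
    have b3 := eq_div_of_mul_eq n3 ((mul_comm _ _).trans a3)
    have m1 := Complex.ofReal_ne_zero.2 (Real.exp_pos
      (∑ j ∈ Finset.range N, Real.log (1 - Real.exp (-((j + 1) * v))))).ne'
    have m2 := Complex.ofReal_ne_zero.2 (Real.exp_pos
      (∑ j ∈ Finset.range M, Real.log (1 - Real.exp (-((j + 1) * v))))).ne'
    rw [g, b3, Real.exp_add, Real.exp_sub, Real.exp_sub, Complex.exp_sub, Complex.exp_sub,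
      Complex.exp_sub, Complex.exp_add, b1, b2]
    push_cast
    push_cast at m1 m2
    have := Complex.exp_ne_zero (n * θ * Complex.I)
    field_simp
    simp only [mul_comm]
  simp only [key] at h1
  rw [intervalIntegral.integral_const_mul] at h1
  rw [div_mul_eq_mul_div, h1]
  field_simp

/-! ### Laplace's method for the Cauchy integral. -/

section

open MeasureTheory

theorem continuous_logFactorSum {v : ℝ} (hv : 0 < v) (X : ℕ) : Continuous (logFactorSum v X) := by
  unfold logFactorSum
  refine continuous_finsetSum _ fun j _ => (Continuous.neg ?_).add continuous_const
  refine Continuous.clog (by fun_prop) fun θ => ?_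
  have hs : 0 < ((j : ℝ) + 1) * v := by positivity
  have hr1 : Real.exp (-(((j : ℝ) + 1) * v)) < 1 := Real.exp_lt_one_iff.2 (by linarith)
  rw [sub_eq_add_neg]
  refine Complex.mem_slitPlane_of_norm_lt_one ?_
  rw [norm_neg, norm_mul, Complex.norm_exp_ofReal_mul_I, Complex.norm_real,
    Real.norm_of_nonneg (Real.exp_pos _).le, mul_one]
  exact hr1

/-- The difference is dominated on the whole line by three integrable functions: `2η` times the
Gaussian (from `|e^w - 1| ≤ 2|w|`), the constant `δ` on the period, and, for the Gaussian beyond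
`θ₀`, half of its exponent frozen at `θ₀`. -/
theorem norm_integral_sub_gaussian_le {f : ℝ → ℂ} (hf : Continuous f) {s θ₀ η δ : ℝ} (hs : 0 < s)
    (hθ₀ : 0 ≤ θ₀) (hη : η ≤ 1) (hθπ : θ₀ < Real.pi)
    (h1 : ∀ θ, |θ| ≤ θ₀ → ∃ w : ℂ, ‖w‖ ≤ η ∧ f θ = Complex.exp (-(s / 2 * θ ^ 2 : ℝ) + w))
    (h2 : ∀ θ, θ₀ < |θ| → |θ| ≤ Real.pi → ‖f θ‖ ≤ δ) :
    ‖(∫ θ in -Real.pi..Real.pi, f θ) - √(2 * Real.pi / s)‖ ≤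
      2 * η * √(2 * Real.pi / s) + 2 * Real.pi * δ
        + Real.exp (-(s * θ₀ ^ 2 / 4)) * √(4 * Real.pi / s) := by
  have hπ := Real.pi_pos
  set S := Set.Ioc (-Real.pi) Real.pi with hS
  have hη0 : 0 ≤ η := by
    obtain ⟨w, hw, -⟩ := h1 0 (by simpa using hθ₀)
    exact (norm_nonneg w).trans hw
  have hδ0 : 0 ≤ δ := (norm_nonneg _).trans (h2 Real.pi (by rwa [abs_of_pos hπ])
    (by rw [abs_of_pos hπ]))
  have i2 : Integrable fun θ : ℝ => Real.exp (-(s / 2) * θ ^ 2) := integrable_exp_neg_mul_sq (by positivity)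
  have i4 : Integrable fun θ : ℝ => Real.exp (-(s / 4) * θ ^ 2) := integrable_exp_neg_mul_sq (by positivity)
  have hSfin : volume S ≠ ⊤ := by rw [hS, Real.volume_Ioc]; exact ENNReal.ofReal_ne_top
  have iδ : Integrable (S.indicator fun _ : ℝ => δ) :=
    (integrableOn_const hSfin).integrable_indicator measurableSet_Ioc
  have if' : Integrable (S.indicator f) :=
    ((hf.integrableOn_Icc (a := -Real.pi) (b := Real.pi)).mono_set Set.Ioc_subset_Icc_self).integrable_indicator
      measurableSet_Ioc
  have v2 : ∫ θ : ℝ, Real.exp (-(s / 2) * θ ^ 2) = √(2 * Real.pi / s) := by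
    rw [integral_gaussian]; congr 1; field_simp
  have v4 : ∫ θ : ℝ, Real.exp (-(s / 4) * θ ^ 2) = √(4 * Real.pi / s) := by
    rw [integral_gaussian]; congr 1; field_simp
  have e1 : (∫ θ in -Real.pi..Real.pi, f θ) = ∫ θ, S.indicator f θ := by
    rw [intervalIntegral.integral_of_le (by linarith), integral_indicator measurableSet_Ioc]
  have e2 : ((√(2 * Real.pi / s) : ℝ) : ℂ) = ∫ θ : ℝ, ((Real.exp (-(s / 2) * θ ^ 2) : ℝ) : ℂ) := by
    rw [← v2, integral_complex_ofReal]
  have i2c : Integrable fun θ : ℝ => ((Real.exp (-(s / 2) * θ ^ 2) : ℝ) : ℂ) := i2.ofReal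
  rw [e1, e2, ← integral_sub if' i2c]
  have hb : ∀ θ : ℝ, ‖S.indicator f θ - ((Real.exp (-(s / 2) * θ ^ 2) : ℝ) : ℂ)‖ ≤
      2 * η * Real.exp (-(s / 2) * θ ^ 2) + S.indicator (fun _ : ℝ => δ) θ
        + Real.exp (-(s * θ₀ ^ 2 / 4)) * Real.exp (-(s / 4) * θ ^ 2) := by
    intro θ
    have hE := Real.exp_pos (-(s / 2) * θ ^ 2)
    have hind : 0 ≤ S.indicator (fun _ : ℝ => δ) θ := Set.indicator_nonneg (fun _ _ => hδ0) θ
    rcases le_or_gt |θ| θ₀ with hθ | hθ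
    · have hmem : θ ∈ S := by
        have := abs_lt.1 (hθ.trans_lt hθπ)
        exact ⟨this.1, this.2.le⟩
      obtain ⟨w, hw, hfw⟩ := h1 θ hθ
      have e3 : S.indicator f θ - ((Real.exp (-(s / 2) * θ ^ 2) : ℝ) : ℂ) =
          ((Real.exp (-(s / 2) * θ ^ 2) : ℝ) : ℂ) * (Complex.exp w - 1) := by
        rw [Set.indicator_of_mem hmem, hfw, Complex.exp_add, Complex.ofReal_exp, mul_sub, mul_one]
        congr 3
        push_cast
        ring
      rw [e3, norm_mul, Complex.norm_real, Real.norm_of_nonneg hE.le]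
      have h3 := Complex.norm_exp_sub_one_le (hw.trans hη)
      have h4 : Real.exp (-(s / 2) * θ ^ 2) * ‖Complex.exp w - 1‖ ≤
          2 * η * Real.exp (-(s / 2) * θ ^ 2) := by
        rw [mul_comm]
        gcongr
        linarith
      have h5 : 0 ≤ Real.exp (-(s * θ₀ ^ 2 / 4)) * Real.exp (-(s / 4) * θ ^ 2) := by positivity
      linarith
    · have h3 : ‖S.indicator f θ‖ ≤ S.indicator (fun _ : ℝ => δ) θ := by
        by_cases hm : θ ∈ S
        · rw [Set.indicator_of_mem hm, Set.indicator_of_mem hm]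
          exact h2 θ hθ (abs_le.2 ⟨hm.1.le, hm.2⟩)
        · rw [Set.indicator_of_notMem hm, Set.indicator_of_notMem hm, norm_zero]
      have h4 : Real.exp (-(s / 2) * θ ^ 2) ≤
          Real.exp (-(s * θ₀ ^ 2 / 4)) * Real.exp (-(s / 4) * θ ^ 2) := by
        rw [← Real.exp_add, Real.exp_le_exp]
        have : θ₀ ^ 2 ≤ θ ^ 2 := by
          rw [← sq_abs θ]
          exact pow_le_pow_left₀ hθ₀ hθ.le 2
        nlinarith
      refine (norm_sub_le _ _).trans ?_
      rw [Complex.norm_real, Real.norm_of_nonneg hE.le]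
      have : 0 ≤ 2 * η * Real.exp (-(s / 2) * θ ^ 2) := by positivity
      linarith
  have hint := ((i2.const_mul (2 * η)).add iδ).add (i4.const_mul (Real.exp (-(s * θ₀ ^ 2 / 4))))
  refine (norm_integral_le_of_norm_le hint (Eventually.of_forall hb)).trans (le_of_eq ?_)
  rw [integral_add' ((i2.const_mul (2 * η)).add iδ) (i4.const_mul _),
    integral_add' (i2.const_mul (2 * η)) iδ, integral_const_mul, integral_const_mul, v2, v4,
    integral_indicator measurableSet_Ioc]
  congr 2
  rw [setIntegral_const, Measure.real, Real.volume_Ioc, ENNReal.toReal_ofReal (by linarith)]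
  rw [smul_eq_mul]
  ring

theorem eventually_exp_neg_rpow_le {ε c : ℝ} (hε : 0 < ε) (hc : 0 < c) :
    ∀ᶠ v : ℝ in nhdsWithin 0 (Set.Ioi 0), Real.exp (-(c * v ^ (-ε))) ≤ v ^ 2 := by
  have h1 : Tendsto (fun x : ℝ => x ^ (2 / ε) * Real.exp (-c * x)) atTop (nhds 0) :=
    tendsto_rpow_mul_exp_neg_mul_atTop_nhds_zero _ _ hc
  have h2 : Tendsto (fun v : ℝ => v ^ (-ε)) (nhdsWithin 0 (Set.Ioi 0)) atTop :=
    tendsto_rpow_neg_nhdsGT_zero (by linarith)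
  have h3 := (h1.comp h2).eventually (ge_mem_nhds (zero_lt_one))
  filter_upwards [h3, self_mem_nhdsWithin] with v hv hv0
  have hv0 : 0 < v := hv0
  simp only [Function.comp] at hv
  rw [← Real.rpow_mul hv0.le] at hv
  have e : -ε * (2 / ε) = -2 := by field_simp
  rw [e, Real.rpow_neg hv0.le, Real.rpow_two, inv_mul_le_iff₀ (by positivity), mul_one] at hv
  rwa [neg_mul] at hv

-- The parameters `n, N, M, L` are quantified inside the filter on `v`; this is where uniformity is
-- secured.
set_option maxHeartbeats 1000000 in
theorem local_integral_approx {ε : ℝ} (hε0 : 0 < ε) (hε1 : ε < 1 / 8) :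
    ∀ᶠ v : ℝ in nhdsWithin 0 (Set.Ioi 0), ∀ (n N M : ℕ) (L : ℝ), 4.8 ≤ N * v → 4.8 ≤ M * v →
      0.3 ≤ L → L ≤ 5 →
      (n : ℝ) * v ^ 2 = debye (N * v) + debye (M * v) - debye ((N + M : ℕ) * v) →
      L = varPrimitive (N * v) + varPrimitive (M * v) - varPrimitive ((N + M : ℕ) * v) →
      ‖(∫ θ in -Real.pi..Real.pi, Complex.exp (logFactorSum v N θ + logFactorSum v M θ
        - logFactorSum v (N + M) θ - n * θ * Complex.I)) - √(2 * Real.pi / (L / v ^ 3))‖ ≤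
        21000 * v ^ (1 / 2 - 2 * ε) * √(2 * Real.pi / (L / v ^ 3)) := by
  have hp : 0 < 1 / 2 - 2 * ε := by linarith
  have hlim : Tendsto (fun v : ℝ => 10380 * v ^ (1 / 2 - 2 * ε)) (nhdsWithin 0 (Set.Ioi 0))
      (nhds 0) := by
    have := ((Real.continuousAt_rpow_const 0 (1 / 2 - 2 * ε) (Or.inr hp.le)).tendsto).const_mul (10380 : ℝ)
    rw [Real.zero_rpow hp.ne', mul_zero] at this
    exact this.mono_left nhdsWithin_le_nhds
  filter_upwards [eventually_exp_neg_rpow_le hε0 (by norm_num : (0 : ℝ) < 1 / 14000),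
    hlim.eventually (ge_mem_nhds zero_lt_one), self_mem_nhdsWithin,
    mem_nhdsWithin_of_mem_nhds (Iio_mem_nhds (by norm_num : (0 : ℝ) < 1 / 4))] with v hv1 hv2 hv0 hv4
  intro n N M L hN hM hL1 hL2 hn hL
  have hv0 : 0 < v := hv0
  have hv4 : v < 1 / 4 := hv4
  have hπ := Real.pi_gt_three
  set p := v ^ (1 / 2 - 2 * ε) with hpdef
  have hp0 : 0 < p := by positivity
  have hle : ∀ a : ℝ, 1 / 2 - 2 * ε ≤ a → v ^ a ≤ p := fun a ha =>
    Real.rpow_le_rpow_of_exponent_ge hv0 (by linarith) ha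
  set s := L / v ^ 3 with hs
  have hs0 : 0 < s := by positivity
  -- Slightly wider than the Gaussian scale `v^{3/2}`: `θ₀²/v³ = v^{-ε}` still tends to infinity,
  -- while the cubic error `θ₀³/v⁴ = v^{1/2-3ε/2}` is below `p`.
  set θ₀ := v ^ (3 / 2 - ε / 2) with hθ₀
  have hθ₀0 : 0 < θ₀ := by positivity
  have hpow : ∀ (a : ℝ) (k m : ℕ), k * (3 / 2 - ε / 2) - m = a → θ₀ ^ k / v ^ m = v ^ a := by
    intro a k m h
    rw [hθ₀, ← Real.rpow_natCast, ← Real.rpow_mul hv0.le, ← Real.rpow_natCast v m,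
      ← Real.rpow_sub hv0]
    congr 1
    linarith
  have b1 : θ₀ / v ≤ p := by
    have := hpow (1 / 2 - ε / 2) 1 1 (by push_cast; ring)
    rw [pow_one, pow_one] at this
    rw [this]
    exact hle _ (by linarith)
  have b2 : θ₀ ^ 2 / v ^ 2 ≤ p := by
    rw [hpow (1 - ε) 2 2 (by push_cast; ring)]
    exact hle _ (by linarith)
  have b3 : θ₀ ^ 3 / v ^ 4 ≤ p := by
    rw [hpow (1 / 2 - 3 / 2 * ε) 3 4 (by push_cast; ring)]
    exact hle _ (by linarith)
  have b4 : θ₀ ^ 2 / v ^ 3 = v ^ (-ε) := hpow (-ε) 2 3 (by push_cast; ring)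
  have hθ1 : θ₀ ≤ 1 := Real.rpow_le_one hv0.le (by linarith) (by linarith)
  have b5 : v ^ (-ε) ≤ 1 / v := by
    rw [one_div, ← Real.rpow_neg_one]
    exact Real.rpow_le_rpow_of_exponent_ge hv0 (by linarith) (by linarith)
  -- the first two cumulants
  set q1 : ℕ → ℝ := fun X => ∑ j ∈ Finset.range X, ((j : ℝ) + 1) / (Real.exp ((j + 1) * v) - 1) with hq1
  set q2 : ℕ → ℝ := fun X => ∑ j ∈ Finset.range X, ((j : ℝ) + 1) ^ 2 * Real.exp ((j + 1) * v) /
        (Real.exp ((j + 1) * v) - 1) ^ 2 with hq2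
  have c1 : |q1 N + q1 M - q1 (N + M) - n| ≤ 3 / v := by
    have hn' : (n : ℝ) = debye (N * v) / v ^ 2 + debye (M * v) / v ^ 2
        - debye ((N + M : ℕ) * v) / v ^ 2 := by
      rw [← add_div, ← sub_div, ← hn]
      field_simp
    have k1 := abs_le.1 (abs_sum_div_exp_sub_one_sub_debye_le hv0 N)
    have k2 := abs_le.1 (abs_sum_div_exp_sub_one_sub_debye_le hv0 M)
    have k3 := abs_le.1 (abs_sum_div_exp_sub_one_sub_debye_le hv0 (N + M))
    have e : 3 / v = 3 * (1 / v) := by ring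
    rw [hn', e, abs_le]
    simp only [hq1]
    constructor <;> linarith [k1.1, k1.2, k2.1, k2.2, k3.1, k3.2]
  have c2 : |q2 N + q2 M - q2 (N + M) - s| ≤ 3 / v ^ 2 := by
    have hs' : s = varPrimitive (N * v) / v ^ 3 + varPrimitive (M * v) / v ^ 3
        - varPrimitive ((N + M : ℕ) * v) / v ^ 3 := by
      rw [← add_div, ← sub_div, ← hL]
    have k1 := abs_le.1 (abs_sum_variance_sub_varPrimitive_le hv0 N)
    have k2 := abs_le.1 (abs_sum_variance_sub_varPrimitive_le hv0 M)
    have k3 := abs_le.1 (abs_sum_variance_sub_varPrimitive_le hv0 (N + M))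
    have e : 3 / v ^ 2 = 3 * (1 / v ^ 2) := by ring
    rw [hs', e, abs_le]
    simp only [hq2]
    constructor <;> linarith [k1.1, k1.2, k2.1, k2.2, k3.1, k3.2]
  -- The three cubic errors and the two cumulant errors add up to `3 * 3456 + 3 + 3/2 ≤ 10380` times
  -- `p`. The final constant then needs `2 * 10380 + 8 + 2 ≤ 21000`.
  have main := norm_integral_sub_gaussian_le (f := fun θ : ℝ => Complex.exp (logFactorSum v N θ
      + logFactorSum v M θ - logFactorSum v (N + M) θ - n * θ * Complex.I))
    (s := s) (θ₀ := θ₀) (η := 10380 * p) (δ := v ^ 2) ?_ hs0 hθ₀0.le hv2 (by linarith) ?_ ?_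
  · refine main.trans ?_
    have t1 : v ^ 2 ≤ p := by
      rw [← Real.rpow_two]
      exact hle _ (by linarith)
    have t2 : v ^ 2 ≤ p * √(2 * Real.pi / s) := by
      -- The Gaussian integral is at least `v^{3/2}` since `L ≤ 5 < 2π`; this makes the absolute
      -- error `v²` a relative one.
      have h1 : v ^ (3 / 2 : ℝ) ≤ √(2 * Real.pi / s) := by
        refine Real.le_sqrt_of_sq_le ?_
        rw [← Real.rpow_natCast, ← Real.rpow_mul hv0.le]
        norm_num
        rw [hs, div_div_eq_mul_div, le_div_iff₀ (by linarith)]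
        have : 0 < v ^ 3 := by positivity
        nlinarith
      have h2 : v ^ (1 / 2 : ℝ) ≤ p := hle _ (by linarith)
      calc v ^ 2 = v ^ (1 / 2 : ℝ) * v ^ (3 / 2 : ℝ) := by
            rw [← Real.rpow_add hv0]; norm_num
        _ ≤ _ := by gcongr
    have t3 : Real.exp (-(s * θ₀ ^ 2 / 4)) ≤ p := by
      refine le_trans ?_ (hv1.trans t1)
      rw [Real.exp_le_exp, neg_le_neg_iff, ← b4, hs]
      have : 0 < θ₀ ^ 2 / v ^ 3 := by positivity
      have e : L / v ^ 3 * θ₀ ^ 2 / 4 = L / 4 * (θ₀ ^ 2 / v ^ 3) := by ring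
      rw [e]
      exact mul_le_mul_of_nonneg_right (by linarith) this.le
    have t4 : √(4 * Real.pi / s) ≤ 2 * √(2 * Real.pi / s) := by
      rw [Real.sqrt_le_left (by positivity), mul_pow, Real.sq_sqrt (by positivity)]
      have : 0 < Real.pi / s := by positivity
      have e1 : 4 * Real.pi / s = 4 * (Real.pi / s) := by ring
      have e2 : 2 ^ 2 * (2 * Real.pi / s) = 8 * (Real.pi / s) := by ring
      rw [e1, e2]
      linarith
    have t5 : Real.exp (-(s * θ₀ ^ 2 / 4)) * √(4 * Real.pi / s) ≤ p * (2 * √(2 * Real.pi / s)) := by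
      gcongr
    have t6 : 2 * Real.pi * v ^ 2 ≤ 8 * (p * √(2 * Real.pi / s)) := by
      have := Real.pi_le_four
      have := sq_nonneg v
      nlinarith
    have t7 : 0 ≤ p * √(2 * Real.pi / s) := by positivity
    linarith
  · exact Complex.continuous_exp.comp ((((continuous_logFactorSum hv0 N).add
      (continuous_logFactorSum hv0 M)).sub (continuous_logFactorSum hv0 (N + M))).sub (by fun_prop))
  · intro θ hθ
    have k1 := norm_logFactorSum_sub_le hv0 N θ
    have k2 := norm_logFactorSum_sub_le hv0 M θ
    have k3 := norm_logFactorSum_sub_le hv0 (N + M) θ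
    refine ⟨logFactorSum v N θ + logFactorSum v M θ - logFactorSum v (N + M) θ - n * θ * Complex.I
      + (s / 2 * θ ^ 2 : ℝ), ?_, ?_⟩
    · have e : logFactorSum v N θ + logFactorSum v M θ - logFactorSum v (N + M) θ - n * θ * Complex.I
          + (s / 2 * θ ^ 2 : ℝ) =
          (logFactorSum v N θ - (θ * (q1 N : ℝ) * Complex.I - θ ^ 2 / 2 * (q2 N : ℝ))) +
          (logFactorSum v M θ - (θ * (q1 M : ℝ) * Complex.I - θ ^ 2 / 2 * (q2 M : ℝ))) -
          (logFactorSum v (N + M) θ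
            - (θ * (q1 (N + M) : ℝ) * Complex.I - θ ^ 2 / 2 * (q2 (N + M) : ℝ))) +
          ((θ * (q1 N + q1 M - q1 (N + M) - n) : ℝ) * Complex.I
            - (θ ^ 2 / 2 * (q2 N + q2 M - q2 (N + M) - s) : ℝ)) := by
        push_cast
        ring
      rw [e]
      have n1 : ‖((θ * (q1 N + q1 M - q1 (N + M) - n) : ℝ) : ℂ) * Complex.I‖ ≤ 3 * (θ₀ / v) := by
        rw [norm_mul, Complex.norm_I, mul_one, Complex.norm_real, Real.norm_eq_abs, abs_mul]
        calc _ ≤ θ₀ * (3 / v) := by gcongr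
          _ = _ := by ring
      have n2 : ‖((θ ^ 2 / 2 * (q2 N + q2 M - q2 (N + M) - s) : ℝ) : ℂ)‖ ≤ 3 / 2 * (θ₀ ^ 2 / v ^ 2) := by
        rw [Complex.norm_real, Real.norm_eq_abs, abs_mul, abs_of_nonneg (by positivity), ← sq_abs θ]
        calc _ ≤ θ₀ ^ 2 / 2 * (3 / v ^ 2) := by gcongr
          _ = _ := by ring
      have n3 : 3456 * |θ| ^ 3 / v ^ 4 ≤ 3456 * p := by
        calc _ ≤ 3456 * θ₀ ^ 3 / v ^ 4 := by gcongr
          _ = 3456 * (θ₀ ^ 3 / v ^ 4) := by ring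
          _ ≤ _ := by gcongr
      refine (norm_add_le_of_le (norm_sub_le_of_le (norm_add_le_of_le k1 k2) k3)
        (norm_sub_le_of_le n1 n2)).trans ?_
      linarith
    · congr 1
      push_cast
      ring
  · intro θ hθ hθπ
    have hne : θ ≠ 0 := by
      rintro rfl
      rw [abs_zero] at hθ
      linarith
    have h := re_logFactorSum_le hv0 hv4.le hne hθπ hN hM
    rw [Complex.norm_exp]
    refine le_trans (Real.exp_le_exp.2 ?_) hv1
    have e : (n * θ * Complex.I : ℂ).re = 0 := by simp
    rw [Complex.sub_re, e, sub_zero]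
    refine h.trans (neg_le_neg ?_)
    gcongr
    refine le_min b5 ?_
    rw [← b4, ← sq_abs θ]
    gcongr

end

/-! ### Matching with the stated main term. -/

theorem sqrt_eq_exp_half_log {x : ℝ} (hx : 0 < x) : √x = Real.exp (Real.log x / 2) := by
  rw [← Real.log_sqrt hx.le, Real.exp_log (Real.sqrt_pos.2 hx)]

/-- With `v = g/√n`, `√(v/2π) * √(2πv³/L) = v²/√L = g²/(n√L)`. This displays the main term as
prefactor times Gaussian integral. -/
theorem mainTerm_eq {n : ℕ} (hn : 0 < n) {α β g : ℝ} (hα : 0 < α) (hβ : 0 < β) (hg : 0 < g)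
    (hL : 0 < saddleL α β g) :
    mainTerm n α β g = Real.exp (√n * saddleK α β g + Real.log (g / √n / (2 * Real.pi)) / 2
      + (Real.log (1 - Real.exp (-((α + β) * g))) - Real.log (1 - Real.exp (-(α * g)))
        - Real.log (1 - Real.exp (-(β * g)))) / 2) / (2 * Real.pi) *
      √(2 * Real.pi / (saddleL α β g / (g / √n) ^ 3)) := by
  have hn' : (0 : ℝ) < n := by exact_mod_cast hn
  have hsn : 0 < √(n : ℝ) := Real.sqrt_pos.2 hn'
  have hpos : ∀ t : ℝ, 0 < t → 0 < 1 - Real.exp (-t) := fun t ht => by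
    have : Real.exp (-t) < 1 := Real.exp_lt_one_iff.2 (by linarith)
    linarith
  have h1 := hpos (α * g) (by positivity)
  have h2 := hpos (β * g) (by positivity)
  have h3 := hpos ((α + β) * g) (by positivity)
  have e1 : √((1 - Real.exp (-((α + β) * g))) / ((1 - Real.exp (-(α * g))) * (1 - Real.exp (-(β * g)))))
      = Real.exp ((Real.log (1 - Real.exp (-((α + β) * g))) - Real.log (1 - Real.exp (-(α * g)))
        - Real.log (1 - Real.exp (-(β * g)))) / 2) := by
    rw [sqrt_eq_exp_half_log (by positivity), Real.log_div h3.ne' (by positivity),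
      Real.log_mul h1.ne' h2.ne']
    congr 2
    ring
  have e2 : √(g / √n / (2 * Real.pi)) * √(2 * Real.pi / (saddleL α β g / (g / √n) ^ 3)) =
      g ^ 2 / (√(saddleL α β g) * n) := by
    rw [← Real.sqrt_mul (by positivity)]
    have : g / √n / (2 * Real.pi) * (2 * Real.pi / (saddleL α β g / (g / √n) ^ 3)) =
        (g / √n) ^ 4 / saddleL α β g := by
      field_simp
    have h4 : (g / √n) ^ 4 = (g ^ 2 / n) ^ 2 := by
      rw [div_pow, div_pow, ← pow_mul, show (√(n : ℝ)) ^ 4 = (√(n : ℝ) ^ 2) ^ 2 by ring,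
        Real.sq_sqrt hn'.le]
    rw [this, Real.sqrt_div (by positivity), h4, Real.sqrt_sq (by positivity)]
    field_simp
  rw [mainTerm, e1, Real.exp_add, Real.exp_add, ← sqrt_eq_exp_half_log (by positivity)]
  calc _ = (g ^ 2 / (√(saddleL α β g) * n)) * Real.exp (√n * saddleK α β g) / (2 * Real.pi) *
        Real.exp ((Real.log (1 - Real.exp (-((α + β) * g))) - Real.log (1 - Real.exp (-(α * g)))
        - Real.log (1 - Real.exp (-(β * g)))) / 2) := by
        have := Real.sqrt_pos.2 hL
        field_simp
    _ = _ := by rw [← e2]; ring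

/-- Of the three Stirling terms `log(2π/v)/2`, taken with signs `+, -, -`, one negative copy
survives. Each summation error is at most `v` because `Xv ≥ 4.8`. -/
theorem abs_log_prefactor_sub_le {v : ℝ} (hv : 0 < v) {N M : ℕ} (hN : 4.8 ≤ N * v) (hM : 4.8 ≤ M * v) :
    |(∑ j ∈ Finset.range (N + M), Real.log (1 - Real.exp (-((j + 1) * v)))
        - ∑ j ∈ Finset.range N, Real.log (1 - Real.exp (-((j + 1) * v)))
        - ∑ j ∈ Finset.range M, Real.log (1 - Real.exp (-((j + 1) * v)))) -
      ((logOneSubExpPrimitive ((N + M : ℕ) * v) - logOneSubExpPrimitive (N * v)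
          - logOneSubExpPrimitive (M * v)) / v
        + Real.log (v / (2 * Real.pi)) / 2
        + (Real.log (1 - Real.exp (-((N + M : ℕ) * v))) - Real.log (1 - Real.exp (-(N * v)))
          - Real.log (1 - Real.exp (-(M * v)))) / 2)| ≤ 3 * v := by
  have hX : ∀ X : ℕ, 4.8 ≤ X * v → X ≠ 0 ∧ v / 2 + 1 / (12 * (X : ℝ)) ≤ v := by
    intro X h
    have h0 : X ≠ 0 := by
      rintro rfl
      norm_num at h
    have hX0 : 0 < (X : ℝ) := by positivity
    refine ⟨h0, ?_⟩
    have : 1 / (12 * (X : ℝ)) ≤ v / 2 := by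
      rw [div_le_div_iff₀ (by positivity) (by norm_num)]
      linarith
    linarith
  obtain ⟨hN0, hN1⟩ := hX N hN
  obtain ⟨hM0, hM1⟩ := hX M hM
  obtain ⟨hT0, hT1⟩ := hX (N + M) (by
    push_cast
    nlinarith)
  have k1 := abs_le.1 ((sum_log_one_sub_exp_neg hv hN0).trans hN1)
  have k2 := abs_le.1 ((sum_log_one_sub_exp_neg hv hM0).trans hM1)
  have k3 := abs_le.1 ((sum_log_one_sub_exp_neg hv hT0).trans hT1)
  have e : Real.log (v / (2 * Real.pi)) = -Real.log (2 * Real.pi / v) := by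
    rw [← Real.log_inv, inv_div]
  rw [e, sub_div, sub_div, abs_le]
  constructor <;> linarith [k1.1, k1.2, k2.1, k2.2, k3.1, k3.2]

theorem abs_restrictedPartitionCount_sub_mainTerm_le {n N M : ℕ} {α β g v e : ℝ} (hn : 0 < n)
    (hα : α = N / √n) (hβ : β = M / √n) (hα4 : 4 ≤ α) (hβ4 : 4 ≤ β) (hg : IsSaddlePoint α β g)
    (hv : v = g / √n) (hv3 : v ≤ 1 / 3)
    (he : ‖(∫ θ in -Real.pi..Real.pi, Complex.exp (logFactorSum v N θ + logFactorSum v M θ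
        - logFactorSum v (N + M) θ - n * θ * Complex.I)) - √(2 * Real.pi / (saddleL α β g / v ^ 3))‖ ≤
        e * √(2 * Real.pi / (saddleL α β g / v ^ 3))) :
    |(restrictedPartitionCount n N M : ℝ) - mainTerm n α β g| ≤
      (3 * e + 6 * v) * mainTerm n α β g := by
  obtain ⟨hg1, hg2⟩ := hg.bounds hα4 hβ4
  have hn' : (0 : ℝ) < n := by exact_mod_cast hn
  have hsn : 0 < √(n : ℝ) := Real.sqrt_pos.2 hn'
  have hv0 : 0 < v := by rw [hv]; positivity
  have hNv : (N : ℝ) * v = α * g := by rw [hα, hv]; ring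
  have hMv : (M : ℝ) * v = β * g := by rw [hβ, hv]; ring
  have hNMv : ((N + M : ℕ) : ℝ) * v = (α + β) * g := by push_cast; rw [add_mul, hNv, hMv]; ring
  have hL := (hg.saddleL_bounds hα4 hβ4).1
  have hmain := mainTerm_eq hn (by linarith) (by linarith) hg.1 (by linarith : 0 < saddleL α β g)
  have hA := abs_log_prefactor_sub_le hv0 (N := N) (M := M) (by rw [hNv]; nlinarith)
    (by rw [hMv]; nlinarith)
  have hint := restrictedPartitionCount_eq_integral hv0 n N M
  rw [← hv] at hmain
  rw [hNv, hMv, hNMv] at hA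
  set lA := ∑ j ∈ Finset.range (N + M), Real.log (1 - Real.exp (-((j + 1) * v)))
        - ∑ j ∈ Finset.range N, Real.log (1 - Real.exp (-((j + 1) * v)))
        - ∑ j ∈ Finset.range M, Real.log (1 - Real.exp (-((j + 1) * v))) with hlA
  set lA₀ := √n * saddleK α β g + Real.log (v / (2 * Real.pi)) / 2
      + (Real.log (1 - Real.exp (-((α + β) * g))) - Real.log (1 - Real.exp (-(α * g)))
        - Real.log (1 - Real.exp (-(β * g)))) / 2 with hlA₀
  set G := √(2 * Real.pi / (saddleL α β g / v ^ 3)) with hG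
  set I := ∫ θ in -Real.pi..Real.pi, Complex.exp (logFactorSum v N θ + logFactorSum v M θ
        - logFactorSum v (N + M) θ - n * θ * Complex.I) with hI
  -- The constants `-π²/6` in the primitives, with signs `+, -, -`, leave the `+π²/6` of `K`, while
  -- `nv = √n g`.
  have hK : √n * saddleK α β g = n * v + (logOneSubExpPrimitive ((α + β) * g)
      - logOneSubExpPrimitive (α * g) - logOneSubExpPrimitive (β * g)) / v := by
    have hgpos := hg.1
    have hnn : (n : ℝ) = √n * √n := (Real.mul_self_sqrt hn'.le).symm
    unfold saddleK logOneSubExpPrimitive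
    rw [hv]
    generalize dilog _ = a, dilog _ = b, dilog _ = c
    nth_rewrite 2 [hnn]
    field_simp
    ring
  have hd : |lA + n * v - lA₀| ≤ 3 * v := by
    refine le_trans (le_of_eq ?_) hA
    congr 1
    rw [hlA₀, hK]
    ring
  have hG0 : 0 ≤ G := Real.sqrt_nonneg _
  have hπ := Real.pi_pos
  have hE0 := Real.exp_pos lA₀
  have hexp : Real.exp (lA + n * v) = Real.exp lA₀ * Real.exp (lA + n * v - lA₀) := by
    rw [← Real.exp_add]; congr 1; ring
  have hd1 := Real.abs_exp_sub_one_le (hd.trans (by linarith : 3 * v ≤ 1))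
  have hd2 : |Real.exp (lA + n * v - lA₀) - 1| ≤ 6 * v := by linarith
  have hd3 : Real.exp (lA + n * v - lA₀) ≤ 3 := by
    have := (abs_le.1 hd2).2
    linarith
  -- The error is separated into that of the integral, scaled by a prefactor ratio of at most 3, and
  -- that of the prefactor, at most `6v`.
  have key : ((restrictedPartitionCount n N M : ℝ) - mainTerm n α β g : ℂ) =
      (Real.exp lA₀ / (2 * Real.pi) : ℝ) * ((Real.exp (lA + n * v - lA₀) : ℝ) * (I - G)
        + ((Real.exp (lA + n * v - lA₀) - 1 : ℝ) * G)) := by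
    rw [Complex.ofReal_natCast, hint, hmain, hexp]
    push_cast
    ring
  have hnorm : |(restrictedPartitionCount n N M : ℝ) - mainTerm n α β g| =
      ‖((restrictedPartitionCount n N M : ℝ) - mainTerm n α β g : ℂ)‖ := by
    rw [← Complex.ofReal_sub, Complex.norm_real, Real.norm_eq_abs]
  rw [hnorm, key, norm_mul, Complex.norm_real, Real.norm_of_nonneg (by positivity), hmain]
  have hb : ‖((Real.exp (lA + n * v - lA₀) : ℝ) * (I - G)
        + ((Real.exp (lA + n * v - lA₀) - 1 : ℝ) * G) : ℂ)‖ ≤ 3 * (e * G) + 6 * v * G := by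
    refine norm_add_le_of_le ?_ ?_
    · rw [norm_mul, Complex.norm_real, Real.norm_of_nonneg (Real.exp_pos _).le]
      gcongr
    · rw [norm_mul, Complex.norm_real, Complex.norm_real, Real.norm_of_nonneg hG0,
        Real.norm_eq_abs]
      gcongr
  calc _ ≤ Real.exp lA₀ / (2 * Real.pi) * (3 * (e * G) + 6 * v * G) := by gcongr
    _ = _ := by ring

theorem theorem1 (ε : ℝ) (hε0 : 0 < ε) (hε1 : ε < 1 / 8) :
    (∀ α β : ℝ, 4 ≤ α → 4 ≤ β →
      (∃! g : ℝ, IsSaddlePoint α β g) ∧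
      (∀ g : ℝ, IsSaddlePoint α β g → 0 < saddleL α β g)) ∧
    (∃ C : ℝ, ∀ᶠ n : ℕ in atTop, ∀ N M : ℕ,
      4 * √(n : ℝ) ≤ (N : ℝ) → 4 * √(n : ℝ) ≤ (M : ℝ) →
      ∀ g : ℝ, IsSaddlePoint ((N : ℝ) / √(n : ℝ)) ((M : ℝ) / √(n : ℝ)) g →
        |(restrictedPartitionCount n N M : ℝ)
            - mainTerm n ((N : ℝ) / √(n : ℝ)) ((M : ℝ) / √(n : ℝ)) g|
          ≤ C * (n : ℝ) ^ (-(1 / 4 : ℝ) + ε)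
            * mainTerm n ((N : ℝ) / √(n : ℝ)) ((M : ℝ) / √(n : ℝ)) g) := by
  -- The constant is `2 * (3 * 21000 + 6)`; the 2 comes from `v^{1/2-2ε} ≤ 2 n^{-1/4+ε}`.
  refine ⟨fun α β hα hβ => ⟨existsUnique_isSaddlePoint hα hβ, fun g hg => ?_⟩, 126012, ?_⟩
  · linarith [(hg.saddleL_bounds hα hβ).1]
  have hloc := (local_integral_approx hε0 hε1).and
    (mem_nhdsWithin_of_mem_nhds (Iio_mem_nhds (by norm_num : (0 : ℝ) < 1 / 3)))
  obtain ⟨V, hV0, hV⟩ := mem_nhdsGT_iff_exists_Ioo_subset.1 hloc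
  have hV0 : 0 < V := hV0
  have hsqrt : Tendsto (fun n : ℕ => √(n : ℝ)) atTop atTop :=
    Real.tendsto_sqrt_atTop.comp tendsto_natCast_atTop_atTop
  -- Since `g ≤ 1.3` for every admissible pair, `√n > 1.3/V` forces `v < V` for all `N, M` at once.
  filter_upwards [eventually_gt_atTop 0, hsqrt.eventually_gt_atTop (1.3 / V)] with n hn hnV
  intro N M hN hM g hg
  have hn' : (0 : ℝ) < n := by exact_mod_cast hn
  have hsn : 0 < √(n : ℝ) := Real.sqrt_pos.2 hn'
  have hα4 : 4 ≤ (N : ℝ) / √n := by rwa [le_div_iff₀ hsn]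
  have hβ4 : 4 ≤ (M : ℝ) / √n := by rwa [le_div_iff₀ hsn]
  obtain ⟨hg1, hg2⟩ := hg.bounds hα4 hβ4
  obtain ⟨hL1, hL2⟩ := hg.saddleL_bounds hα4 hβ4
  have hgpos := hg.1
  set v := g / √n with hv
  have hv0 : 0 < v := by positivity
  have hvV : v < V := by
    rw [hv, div_lt_iff₀ hsn]
    rw [div_lt_iff₀ hV0] at hnV
    linarith
  obtain ⟨hloc1, hv3⟩ := hV ⟨hv0, hvV⟩
  have hv3 : v < 1 / 3 := hv3
  have hNv : (N : ℝ) * v = N / √n * g := by rw [hv]; ring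
  have hMv : (M : ℝ) * v = M / √n * g := by rw [hv]; ring
  have hNMv : ((N + M : ℕ) : ℝ) * v = (N / √n + M / √n) * g := by
    push_cast; rw [add_mul, hNv, hMv]; ring
  have hloc2 := hloc1 n N M (saddleL (N / √n) (M / √n) g) (by rw [hNv]; nlinarith)
    (by rw [hMv]; nlinarith) hL1 hL2
    (by
      rw [hNv, hMv, hNMv]
      have h2 := (isSaddlePoint_iff.1 hg).2
      unfold saddleRHS at h2
      rw [← h2, hv, div_pow, Real.sq_sqrt hn'.le]
      field_simp)
    (by rw [hNv, hMv, hNMv, saddleL_eq hg])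
  have h := abs_restrictedPartitionCount_sub_mainTerm_le hn rfl rfl hα4 hβ4 hg hv hv3.le hloc2
  have hmain0 : 0 ≤ mainTerm n (N / √n) (M / √n) g := by
    rw [mainTerm_eq hn (by linarith) (by linarith) hgpos (by linarith)]
    positivity
  refine h.trans (mul_le_mul_of_nonneg_right ?_ hmain0)
  have hvp : v ≤ v ^ (1 / 2 - 2 * ε) := by
    have := Real.rpow_le_rpow_of_exponent_ge hv0 (by linarith) (by linarith : 1 / 2 - 2 * ε ≤ 1)
    rwa [Real.rpow_one] at this
  have hvn : v ^ (1 / 2 - 2 * ε) ≤ 2 * (n : ℝ) ^ (-(1 / 4 : ℝ) + ε) := by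
    rw [hv, Real.div_rpow hgpos.le hsn.le, Real.sqrt_eq_rpow, ← Real.rpow_mul hn'.le, div_eq_mul_inv,
      ← Real.rpow_neg hn'.le]
    have e1 : -(1 / 2 * (1 / 2 - 2 * ε)) = -(1 / 4 : ℝ) + ε := by ring
    rw [e1]
    gcongr
    calc g ^ (1 / 2 - 2 * ε) ≤ g ^ (1 : ℝ) :=
          Real.rpow_le_rpow_of_exponent_le (by linarith) (by linarith)
      _ ≤ 2 := by rw [Real.rpow_one]; linarith
  linarith
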